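/- Let $n\ge 1$ and let $\mathbb E$ be an $n$-fold vector bundle, i.e. a functor $I\mapsto\mathbb E(I)$ from the cube category of subsets of $\underline n=\{1,\dots,n\}$ (with one arrow $I\to J$ for $J\subseteq I$) to smooth manifolds, with projections $p^I_J\colon \mathbb E(I)\to\mathbb E(J)$, such that each $p^I_{I\setminus\{i\}}$, $i\in I$, carries a smooth vector bundle structure and, for all $i\ne j$ in $I$, the square formed by $\mathbb E(I)$, $\mathbb E(I\setminus\{i\})$, $\mathbb E(I\setminus\{j\})$, $\mathbb E(I\setminus\{i,j\})$ is a double vector bundle. Morphisms are natural transformations by smooth maps that are vector bundle morphisms for all these structures. Write $M=\mathbb E(\emptyset)$. For a partition $\rho$ of $\underline n$ and a union $I$ of blocks of $\rho$, let $\mathbb E^\rho(I)\subseteq\mathbb E(I)$ be the set of all $e$ such that, for every block $B\subseteq I$ of $\rho$ and every $j\in B$, $p^I_{I\setminus\{j\}}(e)$ is the image of $p^I_{I\setminus B}(e)$ under the composition of zero sections $\mathbb E(I\setminus B)\to\mathbb E(I\setminus\{j\})$. These embedded submanifolds form a multiple vector bundle $\mathbb E^\rho$ indexed by the unions of blocks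 of $\rho$ (a core of $\mathbb E$), and morphisms restrict to cores. For $K\subseteq\underline n$ let $\mathbb E^K_K\to M$ be the vector bundle of all $e\in\mathbb E(K)$ such that $p^K_{K\setminus\{j\}}(e)$ is the image of $p^K_\emptyset(e)$ under the composition of zero sections $M\to\mathbb E(K\setminus\{j\})$ for all $j\in K$ (so $\mathbb E^\emptyset_\emptyset=M$ and $\mathbb E^{\{i\}}_{\{i\}}=\mathbb E(\{i\})$). Let $\mathbb E^{\rm dec}(I)=\prod^M_{K\subseteq I}\mathbb E^K_K$ and $\overline{\mathbb E}(I)=\prod^M_{i\in I}\mathbb E(\{i\})$ (fibred products over $M$) be the associated decomposed and vacant decomposed $n$-fold vector bundles, and $\iota\colon\overline{\mathbb E}\to\mathbb E^{\rm dec}$ the embedding by zero components. A linear splitting of $\mathbb E$ is a monomorphism $\Sigma\colon\overline{\mathbb E}\to\mathbb E$ (fibrewise injective in each component) with $\Sigma(\{i\})=\mathrm{id}_{\mathbb E(\{i\})}$ for all $i$. A decomposition of $\mathbb E$ is an isomorphism $\mathcal S\colon\mathbb E^{\rm dec}\to\mathbb E$ that induces the identity on all $\mathbb E^K_K$, $K\subseteq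 \underline n$; a decomposition of $\mathbb E^\rho$ is an isomorphism $(\mathbb E^{\rm dec})^\rho\to\mathbb E^\rho$ that induces the identity on $\mathbb E^K_K$ for all unions $K$ of blocks of $\rho$. For $J\subseteq\underline n$ with $\#J=2$ let $\rho_J$ be the partition of $\underline n$ into $J$ and one-element sets. Let $\Sigma$ be a linear splitting of $\mathbb E$ and, for each $J\subseteq\underline n$ with $\#J=2$, let $\mathcal S^J\colon(\mathbb E^{\rm dec})^{\rho_J}\to\mathbb E^{\rho_J}$ be a decomposition of the highest order core $\mathbb E^{\rho_J}$, such that (i) for all $J_1,J_2$, the restrictions of $\mathcal S^{J_1}$ and $\mathcal S^{J_2}$ to $(\mathbb E^{\rm dec})^{\rho}$ agree, where $\rho$ is the finest common coarsening of $\rho_{J_1}$ and $\rho_{J_2}$; (ii) for all $J$ and all $I\subseteq\underline n\setminus J$, $\Sigma(I)=\mathcal S^J(I)\circ\iota(I)$. Then there exists a unique decomposition $\mathcal S$ of $\mathbb E$ such that $\Sigma=\mathcal S\circ\iota$ and such that the core morphism $\mathcal S^{\rho_J}$ equals $\mathcal S^J$ for every $J\subseteq\underline n$ with $\#J=2$.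 -/

import Mathlib

open scoped Manifold ContDiff
open Diffeology

universe u

/-! ### Smooth structures on subspaces and fibred products -/

/-- The initial diffeology for a family of maps: a map `ℝᵐ → X` is a plot iff all its composites
with the maps of the family are plots.  For a subset of a manifold this is the subspace diffeology,
for a fibred product it is the one induced by the product.  For embedded submanifolds (and fibred
products of vector bundles) its smooth maps are exactly the smooth maps of manifolds. -/
@[reducible]
def initialDiffeology {X : Type*} {κ : Type*} {Y : κ → Type*} (d : ∀ k, DiffeologicalSpace (Y k))
    (f : ∀ k, X → Y k) : DiffeologicalSpace X where
  plots m := {c | ∀ k, @IsPlot (Y k) (d k) m (f k ∘ c)}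
  constant_plots x := fun k => (d k).constant_plots (f k x)
  plot_reparam := fun hp hf k => (d k).plot_reparam (hp k) hf
  locality := fun hp k => (d k).locality fun x => by
    obtain ⟨v, hv, hxv, h⟩ := hp x
    exact ⟨v, hv, hxv, fun hfv hf => h hfv hf k⟩

/-! ### Multiple vector bundles: the underlying algebra -/

/-- A functor from the standard `n`-cube category (subsets of an `n`-element set, with an arrow
`I → J` iff `J ⊆ I`) to smooth spaces, together with operations `add i` and `smul i` on `obj I`
for `i ∈ I`.  They stand for the fibrewise operations of `obj I → obj (I \ {i})`; only the values of
`add i x y` for `i ∈ I` and for `x`, `y` in the same fibre are ever used. -/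
structure CubeData (n : ℕ) where
  obj : Finset (Fin n) → Type u
  diffeology : ∀ I, DiffeologicalSpace (obj I)
  proj : ∀ {I J : Finset (Fin n)}, J ⊆ I → obj I → obj J
  add : ∀ {I : Finset (Fin n)}, Fin n → obj I → obj I → obj I
  smul : ∀ {I : Finset (Fin n)}, Fin n → ℝ → obj I → obj I

namespace CubeData

variable {n : ℕ} (X : CubeData.{u} n)

/-- The bundle projection `p_i : X(I) → X(I \ {i})`. -/
def p {I : Finset (Fin n)} (i : Fin n) (x : X.obj I) : X.obj (I.erase i) :=
  X.proj (Finset.erase_subset i I) x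

/-- The zero vector in the fibre of `p_i : X(I) → X(I \ {i})` that contains `x`,
i.e. the zero section of `p_i` evaluated at `p_i x`. -/
def zeroAt {I : Finset (Fin n)} (i : Fin n) (x : X.obj I) : X.obj I := X.smul i 0 x

/-- For a partition of the index set (given as an equivalence relation `r`) and a union `I` of its
blocks, the core `X^r(I) ⊆ X(I)`: the elements `x` such that for every block `B ⊆ I` and every
`j ∈ B`, the point `p_j x ∈ X(I \ {j})` is in the image of the iterated zero section
`X(I \ B) → X(I \ {j})`, i.e. such that `p_j x` is the zero vector over `I \ {j, k}`
for all `k ∈ B \ {j}`. -/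
def IsCore (r : Setoid (Fin n)) {I : Finset (Fin n)} (x : X.obj I) : Prop :=
  ∀ j ∈ I, ∀ k ∈ I, r j k → j ≠ k → X.p j x = X.zeroAt k (X.p j x)

end CubeData

/-- A functor from the `n`-cube category with fibrewise vector space structures that satisfy the
axioms of an `n`-fold vector bundle except for smoothness and local triviality. -/
structure MultiBundle (n : ℕ) extends CubeData.{u} n where
  proj_refl : ∀ {I : Finset (Fin n)} (x : obj I), proj (Finset.Subset.refl I) x = x
  proj_proj : ∀ {I J K : Finset (Fin n)} (h : J ⊆ I) (h' : K ⊆ J) (x : obj I),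
    proj h' (proj h x) = proj (h'.trans h) x
  /- The fibres of `p_i` are (nonempty) real vector spaces. -/
  p_surjective : ∀ {I : Finset (Fin n)} {i : Fin n}, i ∈ I →
    Function.Surjective (toCubeData.p (I := I) i)
  p_add_self : ∀ {I : Finset (Fin n)} {i : Fin n}, i ∈ I → ∀ x y : obj I,
    toCubeData.p i x = toCubeData.p i y → toCubeData.p i (add i x y) = toCubeData.p i x
  p_smul_self : ∀ {I : Finset (Fin n)} {i : Fin n}, i ∈ I → ∀ (t : ℝ) (x : obj I),
    toCubeData.p i (smul i t x) = toCubeData.p i x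
  add_comm : ∀ {I : Finset (Fin n)} {i : Fin n}, i ∈ I → ∀ x y : obj I,
    toCubeData.p i x = toCubeData.p i y → add i x y = add i y x
  add_assoc : ∀ {I : Finset (Fin n)} {i : Fin n}, i ∈ I → ∀ x y z : obj I,
    toCubeData.p i x = toCubeData.p i y → toCubeData.p i y = toCubeData.p i z →
      add i (add i x y) z = add i x (add i y z)
  zeroAt_eq : ∀ {I : Finset (Fin n)} {i : Fin n}, i ∈ I → ∀ x y : obj I,
    toCubeData.p i x = toCubeData.p i y → toCubeData.zeroAt i x = toCubeData.zeroAt i y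
  add_zeroAt : ∀ {I : Finset (Fin n)} {i : Fin n}, i ∈ I → ∀ x : obj I,
    add i x (toCubeData.zeroAt i x) = x
  one_smul : ∀ {I : Finset (Fin n)} {i : Fin n}, i ∈ I → ∀ x : obj I, smul i 1 x = x
  mul_smul : ∀ {I : Finset (Fin n)} {i : Fin n}, i ∈ I → ∀ (s t : ℝ) (x : obj I),
    smul i (s * t) x = smul i s (smul i t x)
  add_smul : ∀ {I : Finset (Fin n)} {i : Fin n}, i ∈ I → ∀ (s t : ℝ) (x : obj I),
    smul i (s + t) x = add i (smul i s x) (smul i t x)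
  smul_add : ∀ {I : Finset (Fin n)} {i : Fin n}, i ∈ I → ∀ (t : ℝ) (x y : obj I),
    toCubeData.p i x = toCubeData.p i y → smul i t (add i x y) = add i (smul i t x) (smul i t y)
  /- The square over `I`, `I \ {i}`, `I \ {j}`, `I \ {i, j}` is a double vector bundle: the
  projection, addition and scalar multiplication of each structure are linear for the other. -/
  p_add : ∀ {I : Finset (Fin n)} {i j : Fin n}, i ∈ I → j ∈ I → i ≠ j → ∀ x y : obj I,
    toCubeData.p j x = toCubeData.p j y →
      toCubeData.p i (add j x y) = add j (toCubeData.p i x) (toCubeData.p i y)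
  p_smul : ∀ {I : Finset (Fin n)} {i j : Fin n}, i ∈ I → j ∈ I → i ≠ j → ∀ (t : ℝ) (x : obj I),
    toCubeData.p i (smul j t x) = smul j t (toCubeData.p i x)
  interchange : ∀ {I : Finset (Fin n)} {i j : Fin n}, i ∈ I → j ∈ I → i ≠ j →
    ∀ x y z w : obj I,
    toCubeData.p i x = toCubeData.p i y → toCubeData.p i z = toCubeData.p i w →
    toCubeData.p j x = toCubeData.p j z → toCubeData.p j y = toCubeData.p j w →
      add j (add i x y) (add i z w) = add i (add j x z) (add j y w)
  smul_add_of_ne : ∀ {I : Finset (Fin n)} {i j : Fin n}, i ∈ I → j ∈ I → i ≠ j →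
    ∀ (t : ℝ) (x y : obj I), toCubeData.p j x = toCubeData.p j y →
      smul i t (add j x y) = add j (smul i t x) (smul i t y)
  smul_comm_of_ne : ∀ {I : Finset (Fin n)} {i j : Fin n}, i ∈ I → j ∈ I → i ≠ j →
    ∀ (s t : ℝ) (x : obj I), smul i s (smul j t x) = smul j t (smul i s x)

namespace MultiBundle

variable {n : ℕ} (X : MultiBundle.{u} n)

theorem p_p {I : Finset (Fin n)} (i : Fin n) {J : Finset (Fin n)} (h : J ⊆ I) (x : X.obj I) :
    X.p i (X.proj h x)
      = X.proj (Finset.erase_subset_erase i h) (X.p i x) := by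
  simp only [CubeData.p, X.proj_proj]

theorem proj_p {I J : Finset (Fin n)} (i : Fin n) (h : J ⊆ I.erase i) (x : X.obj I) :
    X.proj h (X.p i x) = X.proj (h.trans (Finset.erase_subset i I)) x :=
  X.proj_proj _ _ x

/-- A statement about projections `X(I) → X(J)` that holds for identities and is stable under
composition with `p_i`, for `i ∉ J`, holds in general. -/
theorem proj_induction {J : Finset (Fin n)} {Q : ∀ I, J ⊆ I → Prop}
    (refl : Q J (Finset.Subset.refl J))
    (step : ∀ (I : Finset (Fin n)) (h : J ⊆ I) (i : Fin n) (_ : i ∈ I) (hi' : i ∉ J),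
      Q (I.erase i) (Finset.subset_erase.2 ⟨h, hi'⟩) → Q I h) :
    ∀ I h, Q I h := by
  intro I
  induction I using Finset.strongInduction with
  | H I ih =>
    intro h
    by_cases hIJ : I ⊆ J
    · obtain rfl := Finset.Subset.antisymm hIJ h
      exact refl
    · obtain ⟨i, hi, hi'⟩ := Finset.not_subset.1 hIJ
      exact step I h i hi hi' (ih _ (Finset.erase_ssubset hi) _)

theorem proj_add {I J : Finset (Fin n)} (h : J ⊆ I) {j : Fin n} (hj : j ∈ J) :
    ∀ x y : X.obj I, X.p j x = X.p j y →
      X.proj h (X.add j x y) = X.add j (X.proj h x) (X.proj h y) := by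
  refine proj_induction (J := J) (Q := fun I h => ∀ x y : X.obj I, X.p j x = X.p j y →
      X.proj h (X.add j x y) = X.add j (X.proj h x) (X.proj h y)) ?_ ?_ I h
  · intro x y _
    simp only [X.proj_refl]
  · intro I h i hi hi' ih x y hxy
    have hij : i ≠ j := fun e => hi' (e ▸ hj)
    have := ih (X.p i x) (X.p i y) (by
      have e := congrArg (X.proj (Finset.erase_subset_erase j (Finset.erase_subset i I))) hxy
      simpa only [CubeData.p, X.proj_proj] using e)
    rw [← X.p_add hi (h hj) hij x y hxy] at this
    simpa only [X.proj_p] using this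

theorem proj_smul {I J : Finset (Fin n)} (h : J ⊆ I) {j : Fin n} (hj : j ∈ J) (t : ℝ) :
    ∀ x : X.obj I, X.proj h (X.smul j t x) = X.smul j t (X.proj h x) := by
  refine proj_induction (J := J) (Q := fun I h => ∀ x : X.obj I,
      X.proj h (X.smul j t x) = X.smul j t (X.proj h x)) ?_ ?_ I h
  · intro x
    simp only [X.proj_refl]
  · intro I h i hi hi' ih x
    have hij : i ≠ j := fun e => hi' (e ▸ hj)
    have := ih (X.p i x)
    rw [← X.p_smul hi (h hj) hij t x] at this
    simpa only [X.proj_p] using this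

theorem smul_zeroAt {I : Finset (Fin n)} {i : Fin n} (hi : i ∈ I) (t : ℝ) (x : X.obj I) :
    X.smul i t (X.zeroAt i x) = X.zeroAt i x := by
  simp only [CubeData.zeroAt, ← X.mul_smul hi, mul_zero]

/-- Cores are stable under projections. -/
theorem isCore_proj {r : Setoid (Fin n)} {I J : Finset (Fin n)} (h : J ⊆ I) {x : X.obj I}
    (hx : X.IsCore r x) : X.IsCore r (X.proj h x) := by
  intro j hj k hk hjk hne
  rw [X.p_p j h x]
  conv_lhs => rw [hx j (h hj) k (h hk) hjk hne]
  exact X.proj_smul _ (Finset.mem_erase.2 ⟨hne.symm, hk⟩) 0 _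

/-- Cores are stable under the fibrewise additions. -/
theorem isCore_add {r : Setoid (Fin n)} {I : Finset (Fin n)} {i : Fin n} (hi : i ∈ I)
    {x y : X.obj I} (hx : X.IsCore r x) (hy : X.IsCore r y) (hxy : X.p i x = X.p i y) :
    X.IsCore r (X.add i x y) := by
  intro j hj k hk hjk hne
  rcases eq_or_ne j i with rfl | hji
  · rw [X.p_add_self hj x y hxy]
    exact hx j hj k hk hjk hne
  · have hij' : i ∈ I.erase j := Finset.mem_erase.2 ⟨hji.symm, hi⟩
    have hkj' : k ∈ I.erase j := Finset.mem_erase.2 ⟨hne.symm, hk⟩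
    have hp : X.p i (X.p j x) = X.p i (X.p j y) := by
      have e := congrArg (X.proj (Finset.erase_subset_erase i (Finset.erase_subset j I))) hxy
      simpa only [CubeData.p, X.proj_proj] using e
    rw [X.p_add hj hi hji x y hxy]
    have e1 := hx j hj k hk hjk hne
    have e2 := hy j hj k hk hjk hne
    have : X.zeroAt k (X.add i (X.p j x) (X.p j y))
        = X.add i (X.zeroAt k (X.p j x)) (X.zeroAt k (X.p j y)) := by
      rcases eq_or_ne k i with rfl | hki
      · exact X.smul_add hkj' 0 _ _ hp
      · exact X.smul_add_of_ne hkj' hij' hki 0 _ _ hp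
    rw [this, ← e1, ← e2]

/-- Cores are stable under the fibrewise scalar multiplications. -/
theorem isCore_smul {r : Setoid (Fin n)} {I : Finset (Fin n)} {i : Fin n} (hi : i ∈ I) (t : ℝ)
    {x : X.obj I} (hx : X.IsCore r x) : X.IsCore r (X.smul i t x) := by
  intro j hj k hk hjk hne
  rcases eq_or_ne j i with rfl | hji
  · rw [X.p_smul_self hj t x]
    exact hx j hj k hk hjk hne
  · have hij' : i ∈ I.erase j := Finset.mem_erase.2 ⟨hji.symm, hi⟩
    have hkj' : k ∈ I.erase j := Finset.mem_erase.2 ⟨hne.symm, hk⟩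
    rw [X.p_smul hj hi hji t x]
    have e1 := hx j hj k hk hjk hne
    have : X.zeroAt k (X.smul i t (X.p j x)) = X.smul i t (X.zeroAt k (X.p j x)) := by
      rcases eq_or_ne k i with rfl | hki
      · rw [X.smul_zeroAt hkj']
        simp only [CubeData.zeroAt, ← X.mul_smul hkj', zero_mul]
      · exact X.smul_comm_of_ne hkj' hij' hki 0 t _
    rw [this, ← e1]

theorem isCore_mono {r s : Setoid (Fin n)} (h : r ≤ s) {I : Finset (Fin n)} {x : X.obj I}
    (hx : X.IsCore s x) : X.IsCore r x :=
  fun j hj k hk hjk hne => hx j hj k hk (h hjk) hne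

/-- Over every point of `X(∅)` there is an iterated zero vector in `X(I)`. -/
theorem exists_zero (I : Finset (Fin n)) : ∀ m : X.obj ∅, ∃ z : X.obj I,
    (∀ k ∈ I, z = X.zeroAt k z) ∧ X.proj (Finset.empty_subset I) z = m := by
  refine proj_induction (J := ∅) (Q := fun I h => ∀ m : X.obj ∅, ∃ z : X.obj I,
    (∀ k ∈ I, z = X.zeroAt k z) ∧ X.proj h z = m) ?_ ?_ I (Finset.empty_subset I)
  · exact fun m => ⟨m, by simp, X.proj_refl m⟩
  · intro I _ i hi _ ih m
    obtain ⟨z, hz, hm⟩ := ih m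
    obtain ⟨y, hy⟩ := X.p_surjective hi z
    refine ⟨X.zeroAt i y, ?_, ?_⟩
    · intro k hk
      rcases eq_or_ne k i with rfl | hki
      · exact (X.smul_zeroAt hi 0 y).symm
      · have e : X.zeroAt k (X.zeroAt i y) = X.zeroAt i (X.zeroAt k y) :=
          X.smul_comm_of_ne hk hi hki 0 0 y
        rw [e]
        refine X.zeroAt_eq hi _ _ ?_
        have e2 : X.p i (X.zeroAt k y) = X.zeroAt k (X.p i y) := X.p_smul hi hk hki.symm 0 y
        rw [e2, hy]
        exact hz k (Finset.mem_erase.2 ⟨hki, hk⟩)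
    · rw [← hm, ← hy, ← X.p_smul_self hi 0 y]
      exact (X.proj_p i _ _).symm

/-- The iterated zero vector `0_m ∈ X(I)` over `m ∈ X(∅)`. -/
noncomputable def zeroOver (I : Finset (Fin n)) (m : X.obj ∅) : X.obj I :=
  (X.exists_zero I m).choose

theorem zeroOver_eq {I : Finset (Fin n)} (m : X.obj ∅) {k : Fin n} (hk : k ∈ I) :
    X.zeroOver I m = X.zeroAt k (X.zeroOver I m) :=
  (X.exists_zero I m).choose_spec.1 k hk

theorem proj_zeroOver (I : Finset (Fin n)) (m : X.obj ∅) :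
    X.proj (Finset.empty_subset I) (X.zeroOver I m) = m :=
  (X.exists_zero I m).choose_spec.2

theorem isCore_zeroOver (r : Setoid (Fin n)) (I : Finset (Fin n)) (m : X.obj ∅) :
    X.IsCore r (X.zeroOver I m) := by
  intro j hj k hk _ hne
  conv_lhs => rw [X.zeroOver_eq m hk]
  exact X.p_smul hj hk hne 0 _

/-- A vector in the image of the iterated zero section `X(J) → X(I)` is determined by its
projection to `X(J)`. -/
theorem zero_unique {J : Finset (Fin n)} (I : Finset (Fin n)) (h : J ⊆ I) : ∀ z w : X.obj I,
    (∀ k ∈ I, k ∉ J → z = X.zeroAt k z) → (∀ k ∈ I, k ∉ J → w = X.zeroAt k w) →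
    X.proj h z = X.proj h w → z = w := by
  refine proj_induction (J := J) (Q := fun I h => ∀ z w : X.obj I,
    (∀ k ∈ I, k ∉ J → z = X.zeroAt k z) → (∀ k ∈ I, k ∉ J → w = X.zeroAt k w) →
    X.proj h z = X.proj h w → z = w) ?_ ?_ I h
  · intro z w _ _ h
    simpa only [X.proj_refl] using h
  · intro I _ i hi hi' ih z w hz hw h
    rw [hz i hi hi', hw i hi hi']
    refine X.zeroAt_eq hi _ _ (ih _ _ ?_ ?_ ?_)
    · intro k hk hk'
      obtain ⟨hki, hk⟩ := Finset.mem_erase.1 hk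
      conv_lhs => rw [hz k hk hk']
      exact X.p_smul hi hk hki.symm 0 z
    · intro k hk hk'
      obtain ⟨hki, hk⟩ := Finset.mem_erase.1 hk
      conv_lhs => rw [hw k hk hk']
      exact X.p_smul hi hk hki.symm 0 w
    · simpa only [X.proj_p] using h

/-- Two elements of `X^I_I` over the same base point lie in the same fibre of every `p_i`. -/
theorem p_eq_of_isCore_top {I : Finset (Fin n)} {i : Fin n} (hi : i ∈ I) {x y : X.obj I}
    (hx : X.IsCore ⊤ x) (hy : X.IsCore ⊤ y)
    (h : X.proj (Finset.empty_subset I) x = X.proj (Finset.empty_subset I) y) :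
    X.p i x = X.p i y := by
  refine X.zero_unique _ (Finset.empty_subset _) _ _ ?_ ?_ ?_
  · intro k hk _
    obtain ⟨hki, hk⟩ := Finset.mem_erase.1 hk
    exact hx i hi k hk trivial hki.symm
  · intro k hk _
    obtain ⟨hki, hk⟩ := Finset.mem_erase.1 hk
    exact hy i hi k hk trivial hki.symm
  · simpa only [X.proj_p] using h

end MultiBundle

/-! ### Decomposed multiple vector bundles -/

namespace MultiBundle

variable {n : ℕ} (E : MultiBundle.{u} n)

/-- The fibred product over `M = E(∅)` of the building bundles `A_K = E^K_K`, over all `K ⊆ I` that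
belong to the collection `P`; here `A_∅ = M` (the remaining building bundles are replaced by the
trivial bundle `M → M`). -/
abbrev DecompObj (P : Set (Finset (Fin n))) (h0 : ∅ ∈ P) (I : Finset (Fin n)) : Type u :=
  {x : ∀ K : Finset (Fin n), K ⊆ I → K ∈ P → E.obj K //
    ∀ K hK hP, E.IsCore ⊤ (x K hK hP) ∧
      E.proj (Finset.empty_subset K) (x K hK hP) = x ∅ (Finset.empty_subset I) h0}

section

variable {E} {P : Set (Finset (Fin n))} {h0 : ∅ ∈ P}

/-- The canonical projections of the fibred products. -/
def decompProj {I J : Finset (Fin n)} (h : J ⊆ I) (x : E.DecompObj P h0 I) : E.DecompObj P h0 J :=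
  ⟨fun K hK hP => x.1 K (hK.trans h) hP, fun K hK hP => x.2 K (hK.trans h) hP⟩

/-- The base point in `M` of an element of a fibred product over `M`. -/
def decompBase {I : Finset (Fin n)} (x : E.DecompObj P h0 I) : E.obj ∅ :=
  x.1 ∅ (Finset.empty_subset I) h0

/-- The component in `A_K = E^K_K` of an element of a fibred product. -/
def decompComp {I : Finset (Fin n)} (x : E.DecompObj P h0 I) (K : Finset (Fin n)) (hK : K ⊆ I)
    (hP : K ∈ P) : E.obj K :=
  x.1 K hK hP

theorem decomp_fibre {I : Finset (Fin n)} {i : Fin n} {x y : E.DecompObj P h0 I}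
    (h : decompProj (Finset.erase_subset i I) x = decompProj (Finset.erase_subset i I) y)
    {K : Finset (Fin n)} (hK : K ⊆ I) (hP : K ∈ P) (hi : i ∉ K) : x.1 K hK hP = y.1 K hK hP :=
  congrFun (congrFun (congrFun (congrArg Subtype.val h) K)
    (Finset.subset_erase.2 ⟨hK, hi⟩)) hP

theorem decomp_base_eq {I : Finset (Fin n)} {i : Fin n} {x y : E.DecompObj P h0 I}
    (h : decompProj (Finset.erase_subset i I) x = decompProj (Finset.erase_subset i I) y) :
    decompBase x = decompBase y :=
  decomp_fibre h (Finset.empty_subset I) h0 (by simp)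

theorem decomp_p_eq {I : Finset (Fin n)} {i : Fin n} {x y : E.DecompObj P h0 I}
    (h : decompProj (Finset.erase_subset i I) x = decompProj (Finset.erase_subset i I) y)
    {K : Finset (Fin n)} (hK : K ⊆ I) (hP : K ∈ P) (hi : i ∈ K) :
    E.p i (x.1 K hK hP) = E.p i (y.1 K hK hP) :=
  E.p_eq_of_isCore_top hi (x.2 K hK hP).1 (y.2 K hK hP).1
    (((x.2 K hK hP).2.trans (decomp_base_eq h)).trans (y.2 K hK hP).2.symm)

theorem proj_empty_add {K : Finset (Fin n)} {i : Fin n} (hi : i ∈ K) {x y : E.obj K}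
    (h : E.p i x = E.p i y) :
    E.proj (Finset.empty_subset K) (E.add i x y) = E.proj (Finset.empty_subset K) x := by
  rw [← E.proj_p i (Finset.empty_subset _), E.p_add_self hi _ _ h, E.proj_p]

theorem proj_empty_smul {K : Finset (Fin n)} {i : Fin n} (hi : i ∈ K) (t : ℝ) (x : E.obj K) :
    E.proj (Finset.empty_subset K) (E.smul i t x) = E.proj (Finset.empty_subset K) x := by
  rw [← E.proj_p i (Finset.empty_subset _), E.p_smul_self hi, E.proj_p]

open Classical in
/-- Addition in the fibres of the `i`-th projection: the components in the building bundles `A_K`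
with `i ∈ K` are added fibrewise over `M`, the other ones agree. -/
noncomputable def decompAdd {I : Finset (Fin n)} (i : Fin n) (x y : E.DecompObj P h0 I) :
    E.DecompObj P h0 I :=
  if h : decompProj (Finset.erase_subset i I) x = decompProj (Finset.erase_subset i I) y then
    ⟨fun K hK hP => if i ∈ K then E.add i (x.1 K hK hP) (y.1 K hK hP) else x.1 K hK hP, by
      intro K hK hP
      have hb : (i : Fin n) ∉ (∅ : Finset (Fin n)) := by simp
      simp only [if_neg hb]
      by_cases hi : i ∈ K
      · have hp := decomp_p_eq h hK hP hi
        simp only [if_pos hi]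
        exact ⟨E.isCore_add hi (x.2 K hK hP).1 (y.2 K hK hP).1 hp,
          (proj_empty_add hi hp).trans (x.2 K hK hP).2⟩
      · simp only [if_neg hi]
        exact x.2 K hK hP⟩
  else x

/-- Scalar multiplication in the fibres of the `i`-th projection. -/
noncomputable def decompSmul {I : Finset (Fin n)} (i : Fin n) (t : ℝ) (x : E.DecompObj P h0 I) :
    E.DecompObj P h0 I :=
  ⟨fun K hK hP => if i ∈ K then E.smul i t (x.1 K hK hP) else x.1 K hK hP, by
    intro K hK hP
    have hb : (i : Fin n) ∉ (∅ : Finset (Fin n)) := by simp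
    simp only [if_neg hb]
    by_cases hi : i ∈ K
    · simp only [if_pos hi]
      exact ⟨E.isCore_smul hi t (x.2 K hK hP).1,
        (proj_empty_smul hi t _).trans (x.2 K hK hP).2⟩
    · simp only [if_neg hi]
      exact x.2 K hK hP⟩

theorem decompAdd_val {I : Finset (Fin n)} {i : Fin n} {x y : E.DecompObj P h0 I}
    (h : decompProj (Finset.erase_subset i I) x = decompProj (Finset.erase_subset i I) y)
    (K : Finset (Fin n)) (hK : K ⊆ I) (hP : K ∈ P) :
    (decompAdd i x y).1 K hK hP
      = if i ∈ K then E.add i (x.1 K hK hP) (y.1 K hK hP) else x.1 K hK hP := by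
  rw [decompAdd, dif_pos h]

theorem decompProj_add {I J : Finset (Fin n)} (h : J ⊆ I) {j : Fin n} {x y : E.DecompObj P h0 I}
    (hxy : decompProj (Finset.erase_subset j I) x = decompProj (Finset.erase_subset j I) y) :
    decompProj h (decompAdd j x y) = decompAdd j (decompProj h x) (decompProj h y) := by
  have hxy' : decompProj (Finset.erase_subset j J) (decompProj h x)
      = decompProj (Finset.erase_subset j J) (decompProj h y) :=
    congrArg (decompProj (Finset.erase_subset_erase j h)) hxy
  refine Subtype.ext (funext fun K => funext fun hK => funext fun hP => ?_)
  rw [decompAdd_val hxy']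
  exact decompAdd_val hxy K _ hP

end

/-- The decomposed `n`-fold vector bundle with the building bundles `A_K = E^K_K` of `E` for
`K ∈ P`, and with trivial building bundles otherwise. -/
noncomputable def decomp (P : Set (Finset (Fin n))) (h0 : ∅ ∈ P) : MultiBundle.{u} n where
  obj := E.DecompObj P h0
  diffeology I := initialDiffeology
    (κ := {K : Finset (Fin n) // K ⊆ I ∧ K ∈ P}) (fun K => E.diffeology K.1)
    (fun K x => x.1 K.1 K.2.1 K.2.2)
  proj h := decompProj h
  add i := decompAdd i
  smul i := decompSmul i
  proj_refl x := rfl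
  proj_proj h h' x := rfl
  p_surjective := by
    intro I i hi b
    classical
    refine ⟨⟨fun K hK hP => if h : i ∈ K then E.zeroOver K (decompBase b)
      else b.1 K (Finset.subset_erase.2 ⟨hK, h⟩) hP, ?_⟩, ?_⟩
    · intro K hK hP
      have hb : (i : Fin n) ∉ (∅ : Finset (Fin n)) := by simp
      simp only [dif_neg hb]
      by_cases h : i ∈ K
      · simp only [dif_pos h]
        exact ⟨E.isCore_zeroOver _ _ _, E.proj_zeroOver _ _⟩
      · simp only [dif_neg h]
        exact b.2 K _ hP
    · refine Subtype.ext (funext fun K => funext fun hK => funext fun hP => ?_)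
      exact dif_neg (Finset.subset_erase.1 hK).2
  p_add_self := by
    intro I i hi x y h
    refine Subtype.ext (funext fun K => funext fun hK => funext fun hP => ?_)
    exact (decompAdd_val h K _ hP).trans (if_neg (Finset.subset_erase.1 hK).2)
  p_smul_self := by
    intro I i hi t x
    refine Subtype.ext (funext fun K => funext fun hK => funext fun hP => ?_)
    exact if_neg (Finset.subset_erase.1 hK).2
  add_comm := by
    intro I i hi x y h
    refine Subtype.ext (funext fun K => funext fun hK => funext fun hP => ?_)
    refine (decompAdd_val h K hK hP).trans (Eq.trans ?_ (decompAdd_val (Eq.symm h) K hK hP).symm)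
    by_cases hK' : i ∈ K
    · rw [if_pos hK', if_pos hK']
      exact E.add_comm hK' _ _ (decomp_p_eq h hK hP hK')
    · rw [if_neg hK', if_neg hK']
      exact decomp_fibre h hK hP hK'
  add_assoc := by
    intro I i hi x y z h h'
    have hp : ∀ {x y : E.DecompObj P h0 I},
        decompProj (Finset.erase_subset i I) x = decompProj (Finset.erase_subset i I) y →
        decompProj (Finset.erase_subset i I) (decompAdd i x y)
          = decompProj (Finset.erase_subset i I) x := by
      intro x y h
      refine Subtype.ext (funext fun K => funext fun hK => funext fun hP => ?_)
      exact (decompAdd_val h K _ hP).trans (if_neg (Finset.subset_erase.1 hK).2)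
    refine Subtype.ext (funext fun K => funext fun hK => funext fun hP => ?_)
    refine (decompAdd_val ((hp h).trans (Eq.trans h h')) K hK hP).trans
      (Eq.trans ?_ (decompAdd_val (Eq.trans h (hp h').symm) K hK hP).symm)
    rw [decompAdd_val h, decompAdd_val h']
    by_cases hK' : i ∈ K
    · simp only [if_pos hK']
      exact E.add_assoc hK' _ _ _ (decomp_p_eq h hK hP hK') (decomp_p_eq h' hK hP hK')
    · simp only [if_neg hK']
  zeroAt_eq := by
    intro I i hi x y h
    refine Subtype.ext (funext fun K => funext fun hK => funext fun hP => ?_)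
    change (if i ∈ K then _ else _) = (if i ∈ K then _ else _)
    by_cases hK' : i ∈ K
    · rw [if_pos hK', if_pos hK']
      exact E.zeroAt_eq hK' _ _ (decomp_p_eq h hK hP hK')
    · rw [if_neg hK', if_neg hK']
      exact decomp_fibre h hK hP hK'
  add_zeroAt := by
    intro I i hi x
    have h : decompProj (Finset.erase_subset i I) x
        = decompProj (Finset.erase_subset i I) (decompSmul i 0 x) := by
      refine Subtype.ext (funext fun K => funext fun hK => funext fun hP => ?_)
      exact (if_neg (Finset.subset_erase.1 hK).2).symm
    refine Subtype.ext (funext fun K => funext fun hK => funext fun hP => ?_)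
    refine (decompAdd_val h K hK hP).trans ?_
    by_cases hK' : i ∈ K
    · rw [if_pos hK']
      change E.add i _ (if i ∈ K then _ else _) = _
      rw [if_pos hK']
      exact E.add_zeroAt hK' _
    · rw [if_neg hK']
  one_smul := by
    intro I i hi x
    refine Subtype.ext (funext fun K => funext fun hK => funext fun hP => ?_)
    change (if i ∈ K then _ else _) = _
    split_ifs with hK'
    · exact E.one_smul hK' _
    · rfl
  mul_smul := by
    intro I i hi s t x
    refine Subtype.ext (funext fun K => funext fun hK => funext fun hP => ?_)
    change (if i ∈ K then _ else _)
      = (if i ∈ K then E.smul i s (if i ∈ K then _ else _) else (if i ∈ K then _ else _))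
    by_cases hK' : i ∈ K
    · simp only [if_pos hK']
      exact E.mul_smul hK' _ _ _
    · simp only [if_neg hK']
  add_smul := by
    intro I i hi s t x
    have h : decompProj (Finset.erase_subset i I) (decompSmul i s x)
        = decompProj (Finset.erase_subset i I) (decompSmul i t x) := by
      refine Subtype.ext (funext fun K => funext fun hK => funext fun hP => ?_)
      exact (if_neg (Finset.subset_erase.1 hK).2).trans (if_neg (Finset.subset_erase.1 hK).2).symm
    refine Subtype.ext (funext fun K => funext fun hK => funext fun hP => ?_)
    refine Eq.trans ?_ (decompAdd_val h K hK hP).symm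
    change (if i ∈ K then _ else _) = (if i ∈ K then
      E.add i (if i ∈ K then _ else _) (if i ∈ K then _ else _) else (if i ∈ K then _ else _))
    by_cases hK' : i ∈ K
    · simp only [if_pos hK']
      exact E.add_smul hK' _ _ _
    · simp only [if_neg hK']
  smul_add := by
    intro I i hi t x y h
    have hs : ∀ x : E.DecompObj P h0 I, decompProj (Finset.erase_subset i I) (decompSmul i t x)
        = decompProj (Finset.erase_subset i I) x := by
      intro x
      refine Subtype.ext (funext fun K => funext fun hK => funext fun hP => ?_)
      exact if_neg (Finset.subset_erase.1 hK).2
    have h' := (hs x).trans (Eq.trans h (hs y).symm)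
    refine Subtype.ext (funext fun K => funext fun hK => funext fun hP => ?_)
    refine Eq.trans ?_ (decompAdd_val h' K hK hP).symm
    change (if i ∈ K then E.smul i t ((decompAdd i x y).1 K hK hP) else
      (decompAdd i x y).1 K hK hP) = (if i ∈ K then
      E.add i (if i ∈ K then _ else _) (if i ∈ K then _ else _) else (if i ∈ K then _ else _))
    rw [decompAdd_val h]
    by_cases hK' : i ∈ K
    · simp only [if_pos hK']
      exact E.smul_add hK' _ _ _ (decomp_p_eq h hK hP hK')
    · simp only [if_neg hK']
  p_add := by
    intro I i j hi hj hij x y h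
    exact decompProj_add (Finset.erase_subset i I) h
  p_smul := by
    intro I i j hi hj hij t x
    rfl
  interchange := by
    intro I i j hi hj hij x y z w hxy hzw hxz hyw
    have h1 : decompProj (Finset.erase_subset j I) (decompAdd i x y)
        = decompProj (Finset.erase_subset j I) (decompAdd i z w) := by
      rw [decompProj_add _ hxy, decompProj_add _ hzw]
      exact congrArg₂ (decompAdd i) hxz hyw
    have h2 : decompProj (Finset.erase_subset i I) (decompAdd j x z)
        = decompProj (Finset.erase_subset i I) (decompAdd j y w) := by
      rw [decompProj_add _ hxz, decompProj_add _ hyw]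
      exact congrArg₂ (decompAdd j) hxy hzw
    refine Subtype.ext (funext fun K => funext fun hK => funext fun hP => ?_)
    refine (decompAdd_val h1 K hK hP).trans (Eq.trans ?_ (decompAdd_val h2 K hK hP).symm)
    rw [decompAdd_val hxy, decompAdd_val hzw, decompAdd_val hxz, decompAdd_val hyw]
    by_cases hiK : i ∈ K <;> by_cases hjK : j ∈ K
    · simp only [if_pos hiK, if_pos hjK]
      exact E.interchange hiK hjK hij _ _ _ _ (decomp_p_eq hxy hK hP hiK)
        (decomp_p_eq hzw hK hP hiK) (decomp_p_eq hxz hK hP hjK) (decomp_p_eq hyw hK hP hjK)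
    · simp only [if_pos hiK, if_neg hjK]
    · simp only [if_neg hiK, if_pos hjK]
    · simp only [if_neg hiK, if_neg hjK]
  smul_add_of_ne := by
    intro I i j hi hj hij t x y h
    have h' : decompProj (Finset.erase_subset j I) (decompSmul i t x)
        = decompProj (Finset.erase_subset j I) (decompSmul i t y) :=
      congrArg (decompSmul i t) h
    refine Subtype.ext (funext fun K => funext fun hK => funext fun hP => ?_)
    refine Eq.trans ?_ (decompAdd_val h' K hK hP).symm
    change (if i ∈ K then E.smul i t ((decompAdd j x y).1 K hK hP) else
      (decompAdd j x y).1 K hK hP) = (if j ∈ K then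
      E.add j (if i ∈ K then _ else _) (if i ∈ K then _ else _) else (if i ∈ K then _ else _))
    rw [decompAdd_val h]
    by_cases hiK : i ∈ K <;> by_cases hjK : j ∈ K
    · simp only [if_pos hiK, if_pos hjK]
      exact E.smul_add_of_ne hiK hjK hij _ _ _ (decomp_p_eq h hK hP hjK)
    · simp only [if_pos hiK, if_neg hjK]
    · simp only [if_neg hiK, if_pos hjK]
    · simp only [if_neg hiK, if_neg hjK]
  smul_comm_of_ne := by
    intro I i j hi hj hij s t x
    refine Subtype.ext (funext fun K => funext fun hK => funext fun hP => ?_)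
    change (if i ∈ K then E.smul i s (if j ∈ K then _ else _) else (if j ∈ K then _ else _))
      = (if j ∈ K then E.smul j t (if i ∈ K then _ else _) else (if i ∈ K then _ else _))
    by_cases hiK : i ∈ K <;> by_cases hjK : j ∈ K
    · simp only [if_pos hiK, if_pos hjK]
      exact E.smul_comm_of_ne hiK hjK hij _ _ _
    · simp only [if_pos hiK, if_neg hjK]
    · simp only [if_neg hiK, if_pos hjK]
    · simp only [if_neg hiK, if_neg hjK]

end MultiBundle

/-! ### Smooth `n`-fold vector bundles -/

/-- An `n`-fold vector bundle: every `obj I` is a smooth (finite-dimensional, Hausdorff, second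
countable) manifold whose smooth structure is the given one, all projections are smooth, and
`p_i : obj I → obj (I \ {i})`, with the given fibrewise vector space structure, is a smooth vector
bundle for all `i ∈ I`, that is, it has smooth fibrewise linear local trivialisations. -/
structure NFoldVectorBundle (n : ℕ) extends MultiBundle.{u} n where
  dim : Finset (Fin n) → ℕ
  [topology : ∀ I, TopologicalSpace (obj I)]
  [t2 : ∀ I, T2Space (obj I)]
  [secondCountable : ∀ I, SecondCountableTopology (obj I)]
  [charted : ∀ I, ChartedSpace (EuclideanSpace ℝ (Fin (dim I))) (obj I)]
  [manifold : ∀ I, IsManifold (𝓡 (dim I)) ∞ (obj I)]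
  isPlot_iff : ∀ (I : Finset (Fin n)) (m : ℕ) (c : EuclideanSpace ℝ (Fin m) → obj I),
    @IsPlot (obj I) (diffeology I) m c ↔ ContMDiff (𝓡 m) (𝓡 (dim I)) ∞ c
  smooth_proj : ∀ {I J : Finset (Fin n)} (h : J ⊆ I),
    ContMDiff (𝓡 (dim I)) (𝓡 (dim J)) ∞ (proj h)
  locally_trivial : ∀ (I : Finset (Fin n)) (i : Fin n), i ∈ I → ∃ k : ℕ,
    ∀ b : obj (I.erase i),
    ∃ φ : Bundle.Trivialization (EuclideanSpace ℝ (Fin k)) (toCubeData.p (I := I) i),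
      b ∈ φ.baseSet ∧
      ContMDiffOn (𝓡 (dim I)) ((𝓡 (dim (I.erase i))).prod (𝓡 k)) ∞ φ φ.source ∧
      ContMDiffOn ((𝓡 (dim (I.erase i))).prod (𝓡 k)) (𝓡 (dim I)) ∞
        φ.toOpenPartialHomeomorph.symm φ.target ∧
      (∀ x ∈ φ.source, ∀ y ∈ φ.source, toCubeData.p i x = toCubeData.p i y →
        (φ (add i x y)).2 = (φ x).2 + (φ y).2) ∧
      (∀ x ∈ φ.source, ∀ t : ℝ, (φ (smul i t x)).2 = t • (φ x).2)

/-! ### Morphisms -/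

/-- A morphism of `n`-fold vector bundles: a natural transformation by smooth maps that are linear
in the fibres of every `p_i : X(I) → X(I \ {i})`. -/
@[ext]
structure MultiHom {n : ℕ} (X Y : MultiBundle.{u} n) where
  toFun : ∀ I : Finset (Fin n), X.obj I → Y.obj I
  smooth : ∀ I, @DSmooth _ _ (X.diffeology I) (Y.diffeology I) (toFun I)
  natural : ∀ {I J : Finset (Fin n)} (h : J ⊆ I) (x : X.obj I),
    Y.proj h (toFun I x) = toFun J (X.proj h x)
  map_add : ∀ {I : Finset (Fin n)} {i : Fin n}, i ∈ I → ∀ x y : X.obj I, X.p i x = X.p i y →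
    toFun I (X.add i x y) = Y.add i (toFun I x) (toFun I y)
  map_smul : ∀ {I : Finset (Fin n)} {i : Fin n}, i ∈ I → ∀ (t : ℝ) (x : X.obj I),
    toFun I (X.smul i t x) = Y.smul i t (toFun I x)

namespace MultiHom

variable {n : ℕ} {X Y : MultiBundle.{u} n}

/-- Monomorphisms: all components are injective on the fibres of the vector bundles
`p_i : X(I) → X(I \ {i})`. -/
def IsMono (f : MultiHom X Y) : Prop :=
  ∀ (I : Finset (Fin n)) (i : Fin n), i ∈ I → ∀ x y : X.obj I, X.p i x = X.p i y →
    f.toFun I x = f.toFun I y → x = y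

/-- Isomorphisms: there is an inverse morphism. -/
def IsIso (f : MultiHom X Y) : Prop :=
  ∃ g : MultiHom Y X, (∀ I x, g.toFun I (f.toFun I x) = x) ∧ ∀ I y, f.toFun I (g.toFun I y) = y

theorem isCore_map (f : MultiHom X Y) {r : Setoid (Fin n)} {I : Finset (Fin n)} {x : X.obj I}
    (hx : X.IsCore r x) : Y.IsCore r (f.toFun I x) := by
  intro j hj k hk hjk hne
  have e : Y.p j (f.toFun I x) = f.toFun _ (X.p j x) := f.natural _ x
  rw [e]
  conv_lhs => rw [hx j hj k hk hjk hne]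
  exact f.map_smul (Finset.mem_erase.2 ⟨hne.symm, hk⟩) 0 _

end MultiHom

/-! ### Cores -/

/-- The objects of the cube category of a partition `r`: unions of blocks. -/
def IsBlockUnion {n : ℕ} (r : Setoid (Fin n)) (I : Finset (Fin n)) : Prop :=
  ∀ j k : Fin n, r j k → j ∈ I → k ∈ I

open Classical in
/-- `I \ B` where `B` is the block of `j`. -/
noncomputable def removeBlock {n : ℕ} (r : Setoid (Fin n)) (I : Finset (Fin n)) (j : Fin n) :
    Finset (Fin n) := I.filter fun k => ¬ r j k

theorem removeBlock_subset {n : ℕ} (r : Setoid (Fin n)) (I : Finset (Fin n)) (j : Fin n) :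
    removeBlock r I j ⊆ I := by
  classical exact Finset.filter_subset _ _

namespace MultiBundle

variable {n : ℕ} (X : MultiBundle.{u} n)

/-- The space `X^r(I)` of the core of `X` defined by a partition `r`. -/
def Core (r : Setoid (Fin n)) (I : Finset (Fin n)) : Type u := {x : X.obj I // X.IsCore r x}

/-- `X^r(I)` as a subspace of `X(I)`. -/
@[reducible]
def coreDiffeology (r : Setoid (Fin n)) (I : Finset (Fin n)) : DiffeologicalSpace (X.Core r I) :=
  initialDiffeology (κ := Unit) (fun _ => X.diffeology I) (fun _ => Subtype.val)

variable {X} {r : Setoid (Fin n)} {I : Finset (Fin n)}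

/-- The projections of `X^r` are the restrictions of those of `X`. -/
def coreProj {J : Finset (Fin n)} (h : J ⊆ I) (x : X.Core r I) : X.Core r J :=
  ⟨X.proj h x.1, X.isCore_proj h x.2⟩

/-- Elements of `X^r(I)` in the same fibre over `I \ B`, for `B` the block of `j`, are in the same
fibre of `p_j`. -/
theorem core_fibre {j : Fin n} (hj : j ∈ I) {x y : X.Core r I}
    (h : coreProj (removeBlock_subset r I j) x = coreProj (removeBlock_subset r I j) y) :
    X.p j x.1 = X.p j y.1 := by
  classical
  have hs : removeBlock r I j ⊆ I.erase j := by
    intro k hk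
    obtain ⟨hk, hk'⟩ := Finset.mem_filter.1 hk
    exact Finset.mem_erase.2 ⟨fun e => hk' (e ▸ r.refl _), hk⟩
  have key : ∀ k ∈ I.erase j, k ∉ removeBlock r I j → k ∈ I ∧ r j k ∧ j ≠ k := by
    intro k hk hk'
    obtain ⟨hkj, hk⟩ := Finset.mem_erase.1 hk
    refine ⟨hk, ?_, hkj.symm⟩
    by_contra hc
    exact hk' (Finset.mem_filter.2 ⟨hk, hc⟩)
  refine X.zero_unique _ hs _ _ ?_ ?_ ?_
  · intro k hk hk'
    obtain ⟨h1, h2, h3⟩ := key k hk hk'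
    exact x.2 j hj k h1 h2 h3
  · intro k hk hk'
    obtain ⟨h1, h2, h3⟩ := key k hk hk'
    exact y.2 j hj k h1 h2 h3
  · rw [X.proj_p, X.proj_p]
    exact congrArg Subtype.val h

/-- The addition in the fibres of `X^r(I) → X^r(I \ B)`, for a block `B ⊆ I`, is the addition of
`X` in the direction `j`, for any `j ∈ B`. -/
def coreAdd {j : Fin n} (hj : j ∈ I) (x y : X.Core r I)
    (h : coreProj (removeBlock_subset r I j) x = coreProj (removeBlock_subset r I j) y) :
    X.Core r I :=
  ⟨X.add j x.1 y.1, X.isCore_add hj x.2 y.2 (core_fibre hj h)⟩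

/-- The scalar multiplication in the fibres of `X^r(I) → X^r(I \ B)`, for `j ∈ B`. -/
def coreSmul {j : Fin n} (hj : j ∈ I) (t : ℝ) (x : X.Core r I) : X.Core r I :=
  ⟨X.smul j t x.1, X.isCore_smul hj t x.2⟩

end MultiBundle

/-- A morphism `X^r → Y^r` between the cores defined by a partition `r`: a natural transformation,
on the cube category of `r`, by smooth maps that are linear in the fibres of
`X^r(I) → X^r(I \ B)` for all blocks `B ⊆ I`. -/
@[ext]
structure CoreHom {n : ℕ} (X Y : MultiBundle.{u} n) (r : Setoid (Fin n)) where
  toFun : ∀ I : Finset (Fin n), IsBlockUnion r I → X.Core r I → Y.Core r I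
  smooth : ∀ I hI, @DSmooth _ _ (X.coreDiffeology r I) (Y.coreDiffeology r I) (toFun I hI)
  natural : ∀ {I J : Finset (Fin n)} (hI : IsBlockUnion r I) (hJ : IsBlockUnion r J) (h : J ⊆ I)
    (x : X.Core r I), MultiBundle.coreProj h (toFun I hI x) = toFun J hJ (MultiBundle.coreProj h x)
  map_add : ∀ {I : Finset (Fin n)} (hI : IsBlockUnion r I) {j : Fin n} (hj : j ∈ I)
    (x y : X.Core r I) (h : MultiBundle.coreProj (removeBlock_subset r I j) x
      = MultiBundle.coreProj (removeBlock_subset r I j) y),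
    (toFun I hI (MultiBundle.coreAdd hj x y h)).1 = Y.add j (toFun I hI x).1 (toFun I hI y).1
  map_smul : ∀ {I : Finset (Fin n)} (hI : IsBlockUnion r I) {j : Fin n} (hj : j ∈ I) (t : ℝ)
    (x : X.Core r I),
    toFun I hI (MultiBundle.coreSmul hj t x) = MultiBundle.coreSmul hj t (toFun I hI x)

/-- Isomorphisms of cores: there is an inverse morphism. -/
def CoreHom.IsIso {n : ℕ} {X Y : MultiBundle.{u} n} {r : Setoid (Fin n)} (f : CoreHom X Y r) :
    Prop :=
  ∃ g : CoreHom Y X r, (∀ I hI x, g.toFun I hI (f.toFun I hI x) = x) ∧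
    ∀ I hI y, f.toFun I hI (g.toFun I hI y) = y

/-- The core morphism `f^r : X^r → Y^r` induced by a morphism `f : X → Y` by restriction. -/
def MultiHom.core {n : ℕ} {X Y : MultiBundle.{u} n} (f : MultiHom X Y) (r : Setoid (Fin n)) :
    CoreHom X Y r where
  toFun I _ x := ⟨f.toFun I x.1, f.isCore_map x.2⟩
  smooth I _ := fun m c hc u => f.smooth I m (Subtype.val ∘ c) (hc u)
  natural _ _ h x := Subtype.ext (f.natural h x.1)
  map_add _ _ hj x y h := f.map_add hj x.1 y.1 (MultiBundle.core_fibre hj h)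
  map_smul _ _ hj t x := Subtype.ext (f.map_smul hj t x.1)

/-! ### Linear splittings, decompositions and their compatibility -/

namespace MultiBundle

variable {n : ℕ} (E : MultiBundle.{u} n)

/-- The decomposed `n`-fold vector bundle `E^dec` with the same building bundles as `E`:
`E^dec(I)` is the fibred product over `M` of all `E^K_K`, `K ⊆ I`. -/
noncomputable def dec : MultiBundle.{u} n := E.decomp Set.univ (Set.mem_univ _)

/-- The vacant decomposed `n`-fold vector bundle: `vacant(I)` is the fibred product over `M` of the
lower sides `E({i})`, `i ∈ I`. -/
noncomputable def vacant : MultiBundle.{u} n :=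
  E.decomp {K | K.card ≤ 1} (Nat.zero_le 1)

open Classical in
/-- The embedding `ι(I) : vacant(I) → E^dec(I)`, given by the zero elements of the building bundles
`E^K_K` with `#K ≥ 2`. -/
noncomputable def ι (I : Finset (Fin n)) (x : E.vacant.obj I) : E.dec.obj I :=
  let y : E.DecompObj {K | K.card ≤ 1} (Nat.zero_le 1) I := x
  ⟨fun K hK _ => if h : K.card ≤ 1 then y.1 K hK h else E.zeroOver K (decompBase y), by
    intro K hK _
    have h0 : (∅ : Finset (Fin n)).card ≤ 1 := Nat.zero_le 1
    simp only [dif_pos h0]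
    by_cases h : K.card ≤ 1
    · simp only [dif_pos h]
      exact y.2 K hK h
    · simp only [dif_neg h]
      exact ⟨E.isCore_zeroOver _ _ _, E.proj_zeroOver _ _⟩⟩

/-- The component in `A_I = E^I_I` of an element of `E^dec(I)`. -/
def top {I : Finset (Fin n)} (x : E.dec.obj I) : E.obj I :=
  decompComp (h0 := Set.mem_univ _) x I (Finset.Subset.refl I) (Set.mem_univ I)

/-- The component in `E({i})` of an element of `vacant({i})`. -/
def lower (i : Fin n) (x : E.vacant.obj {i}) : E.obj {i} :=
  decompComp (P := {K | K.card ≤ 1}) (h0 := Nat.zero_le 1) x {i} (Finset.Subset.refl _)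
    (Finset.card_singleton i).le

/-- A linear splitting: a monomorphism from the vacant decomposed bundle which is the identity on
the lower sides `E({i})`. -/
def IsLinearSplitting (S : MultiHom E.vacant E) : Prop :=
  S.IsMono ∧ ∀ (i : Fin n) (x : E.vacant.obj {i}),
    S.toFun {i} x = E.lower i x

/-- A decomposition: an isomorphism `S : E^dec → E` whose core morphisms
`(E^dec)^I_I = E^I_I → E^I_I` are the identities, for all `I`.  For `I = {i}` this says that `S` is
the identity on the lower side `E({i})`, for `I = ∅` that it is the identity on `M`. -/
def IsDecomposition (S : MultiHom E.dec E) : Prop :=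
  S.IsIso ∧ ∀ (I : Finset (Fin n)) (x : E.dec.obj I), E.dec.IsCore ⊤ x → S.toFun I x = E.top x

/-- A decomposition `(E^dec)^r → E^r` of the core `E^r`: an isomorphism whose core morphisms
`(E^dec)^I_I = E^I_I → E^I_I` are the identities, for all unions `I` of blocks.  (The lower sides
of `E^r` are the `E^B_B` for the blocks `B`.) -/
def IsCoreDecomposition {r : Setoid (Fin n)} (S : CoreHom E.dec E r) : Prop :=
  S.IsIso ∧ ∀ (I : Finset (Fin n)) (hI : IsBlockUnion r I) (x : E.dec.Core r I),
    E.dec.IsCore ⊤ x.1 → (S.toFun I hI x).1 = E.top x.1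

end MultiBundle

/-- The partition `ρ_J` of the index set into `J` and one-element sets. -/
def blockPartition {n : ℕ} (J : Finset (Fin n)) : Setoid (Fin n) where
  r j k := j = k ∨ (j ∈ J ∧ k ∈ J)
  iseqv := by
    refine ⟨fun _ => Or.inl rfl, ?_, ?_⟩
    · rintro j k (rfl | ⟨h, h'⟩)
      · exact Or.inl rfl
      · exact Or.inr ⟨h', h⟩
    · rintro j k l (rfl | ⟨h, h'⟩) (rfl | ⟨h1, h1'⟩)
      · exact Or.inl rfl
      · exact Or.inr ⟨h1, h1'⟩
      · exact Or.inr ⟨h, h'⟩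
      · exact Or.inr ⟨h, h1'⟩

theorem IsBlockUnion.mono {n : ℕ} {r s : Setoid (Fin n)} (h : r ≤ s) {I : Finset (Fin n)}
    (hI : IsBlockUnion s I) : IsBlockUnion r I :=
  fun j k hjk hj => hI j k (h hjk) hj

theorem isBlockUnion_of_disjoint {n : ℕ} {J I : Finset (Fin n)} (h : Disjoint I J) :
    IsBlockUnion (blockPartition J) I := by
  rintro j k (rfl | ⟨h1, _⟩) hj
  · exact hj
  · exact absurd h1 (Finset.disjoint_left.1 h hj)

namespace MultiBundle

variable {n : ℕ} {E : MultiBundle.{u} n}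

/-- On the common face of `X` and of its core, the core is all of `X(I)`. -/
theorem isCore_of_disjoint {X : MultiBundle.{u} n} {J I : Finset (Fin n)} (h : Disjoint I J)
    (x : X.obj I) : X.IsCore (blockPartition J) x := by
  rintro j hj k hk (e | ⟨h1, _⟩) hne
  · exact absurd e hne
  · exact absurd h1 (Finset.disjoint_left.1 h hj)

/-- Decompositions of the cores defined by `r` and `s` are compatible if they agree on the common
core, which is defined by the finest common coarsening `r ⊔ s`. -/
def Compatible {r s : Setoid (Fin n)} (S : CoreHom E.dec E r) (T : CoreHom E.dec E s) : Prop :=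
  ∀ (I : Finset (Fin n)) (hI : IsBlockUnion (r ⊔ s) I) (x : E.dec.Core (r ⊔ s) I),
    (S.toFun I (hI.mono le_sup_left) ⟨x.1, E.dec.isCore_mono le_sup_left x.2⟩).1
      = (T.toFun I (hI.mono le_sup_right) ⟨x.1, E.dec.isCore_mono le_sup_right x.2⟩).1

/-- A linear splitting is compatible with a decomposition of the core defined by `J` if
`Σ(I) = S(I) ∘ ι(I)` on the common face, i.e. for all `I` disjoint from `J`. -/
def SplittingCompatible (S : MultiHom E.vacant E) {J : Finset (Fin n)}
    (T : CoreHom E.dec E (blockPartition J)) : Prop :=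
  ∀ (I : Finset (Fin n)) (h : Disjoint I J) (x : E.vacant.obj I),
    S.toFun I x = (T.toFun I (isBlockUnion_of_disjoint h) ⟨E.ι I x, isCore_of_disjoint h _⟩).1

end MultiBundle

/-!
The elements of `E^dec(I)` are families of components in the building bundles `E^K_K`, `K ⊆ I`.
For a collection `P` of subsets of the index set let `trunc P` replace the components with `K ∉ P`
by zero. The proof adds the components with `#K ≥ 2` one at a time.

The basic operation is the *shift* `y ↦ y +_i (0_i y +_j t)` of a point `y` of `X(I)` by an element
`t` of the core defined by `{i, j}` over the same point of `X(I \ {i, j})`. By the interchange laws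
it commutes with morphisms, with core morphisms and with all fibrewise operations. If `K ∉ P` and
`i ≠ j` are in `K ⊆ I`, then `trunc (insert K P) x` is the shift of `trunc P x` by the truncation
of `x` to `K` and the members of `P` that contain neither `i` nor `j` (`trunc_insert`), and this
truncation lies in the core defined by `{i, j}`.

* Uniqueness (`multiHom_ext`): a morphism that is known on `trunc P x` and on the highest order
  cores is thereby known on `trunc (insert K P) x`; the induction starts with the image of `ι`.
* Existence (`exists_isPartialDecomposition_univ`): for the same reason a morphism that is
  compatible with `Σ` and all `S^J` on the elements supported in `P` can be extended to
  `insert K P`, by shifting with values of `S^{i, j}`. The shifted maps are again natural and linear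
  in all directions. On the core defined by another `J`, the map `S^J` commutes with the shift, and
  agrees with `S^{i, j}` on the shifting element because that element lies in both cores, hence in
  the core of the coarsening (`isCore_sup`). So the extension is compatible with every `S^J`.
* Invertibility (`isIso_of_core_id`): a morphism `S : E^dec → E` that is the identity on the
  building bundles is invertible. By induction on `I`, all components of a preimage of `e ∈ E(I)`
  except for the one in `E^I_I` are known. Subtracting from `e`, successively in all directions of
  `I`, the image of the element of `E^dec(I)` with these components leaves an element of `E^I_I`,
  which is the missing component. It depends smoothly on `e`, since the fibrewise operations are
  smooth.
-/

/-! ### Linear algebra in multiple vector bundles -/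

namespace MultiBundle

variable {n : ℕ} {X Y : MultiBundle.{u} n} {I : Finset (Fin n)} {i j l : Fin n}

theorem p_p_congr (i : Fin n) {x y : X.obj I} (h : X.p l x = X.p l y) :
    X.p l (X.p i x) = X.p l (X.p i y) := by
  have e := congrArg (X.proj (Finset.erase_subset_erase l (Finset.erase_subset i I))) h
  simpa only [CubeData.p, X.proj_proj] using e

theorem p_zeroAt_self (hi : i ∈ I) (x : X.obj I) : X.p i (X.zeroAt i x) = X.p i x :=
  X.p_smul_self hi 0 x

theorem p_zeroAt (hi : i ∈ I) (hj : j ∈ I) (hij : i ≠ j) (x : X.obj I) :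
    X.p i (X.zeroAt j x) = X.zeroAt j (X.p i x) :=
  X.p_smul hi hj hij 0 x

theorem zeroAt_add (hi : i ∈ I) (x : X.obj I) : X.add i (X.zeroAt i x) x = x := by
  rw [X.add_comm hi _ _ (p_zeroAt_self hi x), X.add_zeroAt hi]

theorem zeroAt_zeroAt (hi : i ∈ I) (x : X.obj I) :
    X.zeroAt i (X.zeroAt i x) = X.zeroAt i x :=
  X.smul_zeroAt hi 0 x

theorem add_neg_self (hi : i ∈ I) (x : X.obj I) :
    X.add i x (X.smul i (-1) x) = X.zeroAt i x := by
  conv_lhs => rw [← X.one_smul hi x, ← X.mul_smul hi, ← X.add_smul hi]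
  norm_num
  rfl

theorem neg_add_self (hi : i ∈ I) (x : X.obj I) :
    X.add i (X.smul i (-1) x) x = X.zeroAt i x := by
  rw [X.add_comm hi _ _ (X.p_smul_self hi _ _), add_neg_self hi]

theorem add_neg_add (hi : i ∈ I) {x y : X.obj I} (h : X.p i x = X.p i y) :
    X.add i (X.add i x (X.smul i (-1) y)) y = x := by
  rw [X.add_assoc hi _ _ _ (h.trans (X.p_smul_self hi _ _).symm) (X.p_smul_self hi _ _),
    neg_add_self hi, X.zeroAt_eq hi _ _ h.symm, X.add_zeroAt hi]

theorem p_add_congr (hi : i ∈ I) (hl : l ∈ I) {x y x' y' : X.obj I} (hx : X.p l x = X.p l x')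
    (hy : X.p l y = X.p l y') (h : X.p i x = X.p i y) (h' : X.p i x' = X.p i y') :
    X.p l (X.add i x y) = X.p l (X.add i x' y') := by
  rcases eq_or_ne l i with rfl | hli
  · rw [X.p_add_self hi _ _ h, X.p_add_self hi _ _ h', hx]
  · rw [X.p_add hl hi hli _ _ h, X.p_add hl hi hli _ _ h', hx, hy]

theorem p_smul_congr (hi : i ∈ I) (hl : l ∈ I) (t : ℝ) {x x' : X.obj I}
    (hx : X.p l x = X.p l x') : X.p l (X.smul i t x) = X.p l (X.smul i t x') := by
  rcases eq_or_ne l i with rfl | hli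
  · rw [X.p_smul_self hi, X.p_smul_self hi, hx]
  · rw [X.p_smul hl hi hli, X.p_smul hl hi hli, hx]

/-- The interchange law for two directions that are allowed to coincide. -/
theorem add_add_add_comm (hi : i ∈ I) (hj : j ∈ I) {x y z w : X.obj I}
    (hxy : X.p i x = X.p i y) (hzw : X.p i z = X.p i w)
    (hxz : X.p j x = X.p j z) (hyw : X.p j y = X.p j w) :
    X.add j (X.add i x y) (X.add i z w) = X.add i (X.add j x z) (X.add j y w) := by
  rcases eq_or_ne i j with rfl | hij
  · have hyz : X.p i y = X.p i z := hxy.symm.trans hxz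
    rw [X.add_assoc hi x y _ hxy ((hyz.trans (X.p_add_self hi _ _ hzw).symm)),
      X.add_assoc hi x z _ hxz (hzw.trans (hyw.symm.trans (X.p_add_self hi _ _ hyw).symm)),
      ← X.add_assoc hi y z w hyz hzw, ← X.add_assoc hi z y w hyz.symm hyw,
      X.add_comm hi y z hyz]
  · exact X.interchange hi hj hij _ _ _ _ hxy hzw hxz hyw

theorem smul_add_any (hi : i ∈ I) (hj : j ∈ I) (t : ℝ) {x y : X.obj I}
    (h : X.p j x = X.p j y) :
    X.smul i t (X.add j x y) = X.add j (X.smul i t x) (X.smul i t y) := by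
  rcases eq_or_ne i j with rfl | hij
  · exact X.smul_add hi t x y h
  · exact X.smul_add_of_ne hi hj hij t x y h

theorem smul_comm_any (hi : i ∈ I) (hj : j ∈ I) (s t : ℝ) (x : X.obj I) :
    X.smul i s (X.smul j t x) = X.smul j t (X.smul i s x) := by
  rcases eq_or_ne i j with rfl | hij
  · rw [← X.mul_smul hi, ← X.mul_smul hi, mul_comm]
  · exact X.smul_comm_of_ne hi hj hij s t x

/-- The point `t` of `X(I)` is a core element for the directions `i`, `j` that lies over the same
point of `X(I \ {i, j})` as `y`. -/
structure Shiftable (i j : Fin n) (y t : X.obj I) : Prop where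
  left : X.p i t = X.zeroAt j (X.p i y)
  right : X.p j t = X.zeroAt i (X.p j y)

variable (X) in
/-- The action of a core element `t` for the directions `i`, `j` on the points `y` of `X(I)` over
the same point of `X(I \ {i, j})`: the fibres of `X(I) → X(I \ {i}) × X(I \ {j})` (fibred product
over `X(I \ {i, j})`) are affine spaces modelled on these core elements.  Only meaningful if
`Shiftable i j y t`. -/
def shift (i j : Fin n) (y t : X.obj I) : X.obj I := X.add i y (X.add j (X.zeroAt i y) t)

/-- A core element whose core component vanishes acts trivially. -/
theorem shift_eq_self (hi : i ∈ I) (hj : j ∈ I) {y t : X.obj I}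
    (h : X.p j (X.zeroAt i y) = X.p j t) (ht : t = X.zeroAt j t) :
    X.shift i j y t = y := by
  have e : t = X.zeroAt j (X.zeroAt i y) := ht.trans (X.zeroAt_eq hj _ _ h.symm)
  rw [shift, e, X.add_zeroAt hj, X.add_zeroAt hi]

section shift

variable (hi : i ∈ I) (hj : j ∈ I) (hij : i ≠ j) {y t y' t' : X.obj I}

include hi hj hij

theorem Shiftable.inner (h : Shiftable i j y t) : X.p j (X.zeroAt i y) = X.p j t := by
  rw [h.right, p_zeroAt hj hi hij.symm]

theorem Shiftable.outer (h : Shiftable i j y t) :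
    X.p i y = X.p i (X.add j (X.zeroAt i y) t) := by
  rw [X.p_add hi hj hij _ _ (h.inner hi hj hij), h.left, p_zeroAt_self hi,
    X.add_zeroAt (Finset.mem_erase.2 ⟨hij.symm, hj⟩)]

theorem p_left_shift (h : Shiftable i j y t) : X.p i (X.shift i j y t) = X.p i y :=
  X.p_add_self hi _ _ (h.outer hi hj hij)

theorem p_right_shift (h : Shiftable i j y t) : X.p j (X.shift i j y t) = X.p j y := by
  rw [shift, X.p_add hj hi hij.symm _ _ (h.outer hi hj hij),
    X.p_add_self hj _ _ (h.inner hi hj hij), p_zeroAt hj hi hij.symm,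
    X.add_zeroAt (Finset.mem_erase.2 ⟨hij, hi⟩)]

theorem p_shift (hl : l ∈ I) (hli : l ≠ i) (hlj : l ≠ j) (h : Shiftable i j y t) :
    X.p l (X.shift i j y t) = X.shift i j (X.p l y) (X.p l t) := by
  rw [shift, X.p_add hl hi hli _ _ (h.outer hi hj hij),
    X.p_add hl hj hlj _ _ (h.inner hi hj hij), p_zeroAt hl hi hli, shift]

theorem shift_add (hl : l ∈ I) (h : Shiftable i j y t) (h' : Shiftable i j y' t')
    (hy : X.p l y = X.p l y') (ht : X.p l t = X.p l t') :
    X.shift i j (X.add l y y') (X.add l t t')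
      = X.add l (X.shift i j y t) (X.shift i j y' t') := by
  have h1 : X.p l (X.zeroAt i y) = X.p l (X.zeroAt i y') := p_smul_congr hi hl 0 hy
  have h2 := h.inner hi hj hij
  have h2' := h'.inner hi hj hij
  have e : X.zeroAt i (X.add l y y') = X.add l (X.zeroAt i y) (X.zeroAt i y') :=
    smul_add_any hi hl 0 hy
  rw [shift, shift, shift, e, ← add_add_add_comm hj hl h2 h2' h1 ht,
    ← add_add_add_comm hi hl (h.outer hi hj hij) (h'.outer hi hj hij) hy
      (p_add_congr hj hl h1 ht h2 h2')]

theorem shift_smul (hl : l ∈ I) (s : ℝ) (h : Shiftable i j y t) :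
    X.shift i j (X.smul l s y) (X.smul l s t) = X.smul l s (X.shift i j y t) := by
  have e : X.zeroAt i (X.smul l s y) = X.smul l s (X.zeroAt i y) := smul_comm_any hi hl 0 s y
  rw [shift, shift, e, smul_add_any hl hi s (h.outer hi hj hij),
    smul_add_any hl hj s (h.inner hi hj hij)]

/-- `t` can act on `y` if it is a core element over the same point of `X(I \ {i, j})`. -/
theorem Shiftable.of_proj {J : Finset (Fin n)} (hJ : J ⊆ I)
    (hJ' : ∀ k ∈ I, k ∉ J → k = i ∨ k = j)
    (h1 : X.p i t = X.zeroAt j (X.p i t)) (h2 : X.p j t = X.zeroAt i (X.p j t))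
    (hiJ : i ∉ J) (hjJ : j ∉ J) (h : X.proj hJ t = X.proj hJ y) : Shiftable i j y t := by
  have hjI : j ∈ I.erase i := Finset.mem_erase.2 ⟨hij.symm, hj⟩
  have hiI : i ∈ I.erase j := Finset.mem_erase.2 ⟨hij, hi⟩
  constructor
  · rw [h1]
    refine X.zeroAt_eq hjI _ _ ?_
    refine X.zero_unique _ (J := J)
      (Finset.subset_erase.2 ⟨Finset.subset_erase.2 ⟨hJ, hiJ⟩, hjJ⟩) _ _ ?_ ?_ ?_
    · intro k hk hkJ
      simp only [Finset.mem_erase] at hk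
      rcases hJ' k hk.2.2 hkJ with rfl | rfl
      exacts [absurd rfl hk.2.1, absurd rfl hk.1]
    · intro k hk hkJ
      simp only [Finset.mem_erase] at hk
      rcases hJ' k hk.2.2 hkJ with rfl | rfl
      exacts [absurd rfl hk.2.1, absurd rfl hk.1]
    · simpa only [X.proj_p] using h
  · rw [h2]
    refine X.zeroAt_eq hiI _ _ ?_
    refine X.zero_unique _ (J := J)
      (Finset.subset_erase.2 ⟨Finset.subset_erase.2 ⟨hJ, hjJ⟩, hiJ⟩) _ _ ?_ ?_ ?_
    · intro k hk hkJ
      simp only [Finset.mem_erase] at hk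
      rcases hJ' k hk.2.2 hkJ with rfl | rfl
      exacts [absurd rfl hk.1, absurd rfl hk.2.1]
    · intro k hk hkJ
      simp only [Finset.mem_erase] at hk
      rcases hJ' k hk.2.2 hkJ with rfl | rfl
      exacts [absurd rfl hk.1, absurd rfl hk.2.1]
    · simpa only [X.proj_p] using h

end shift

theorem _root_.MultiHom.p_map (f : MultiHom X Y) (i : Fin n) (x : X.obj I) :
    Y.p i (f.toFun I x) = f.toFun _ (X.p i x) :=
  f.natural _ x

theorem _root_.MultiHom.p_map_congr (f : MultiHom X Y) {x y : X.obj I} (h : X.p i x = X.p i y) :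
    Y.p i (f.toFun I x) = Y.p i (f.toFun I y) := by
  rw [f.p_map, f.p_map, h]

theorem _root_.MultiHom.map_zeroAt (f : MultiHom X Y) (hi : i ∈ I) (x : X.obj I) :
    f.toFun I (X.zeroAt i x) = Y.zeroAt i (f.toFun I x) :=
  f.map_smul hi 0 x

theorem _root_.MultiHom.map_shift (f : MultiHom X Y) (hi : i ∈ I) (hj : j ∈ I) (hij : i ≠ j)
    {y t : X.obj I} (h : Shiftable i j y t) :
    f.toFun I (X.shift i j y t) = Y.shift i j (f.toFun I y) (f.toFun I t) := by
  rw [shift, f.map_add hi _ _ (h.outer hi hj hij), f.map_add hj _ _ (h.inner hi hj hij),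
    f.map_zeroAt hi, shift]

/-- A morphism is natural as soon as it is natural for the projections `p_i`. -/
theorem natural_of_p {f : ∀ I, X.obj I → Y.obj I}
    (h : ∀ (I : Finset (Fin n)) (i : Fin n), i ∈ I → ∀ x : X.obj I,
      Y.p i (f I x) = f _ (X.p i x))
    {I J : Finset (Fin n)} (hJ : J ⊆ I) (x : X.obj I) :
    Y.proj hJ (f I x) = f J (X.proj hJ x) := by
  revert x
  refine proj_induction (J := J) (Q := fun I hJ => ∀ x : X.obj I,
    Y.proj hJ (f I x) = f J (X.proj hJ x)) ?_ ?_ I hJ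
  · intro x
    rw [X.proj_refl, Y.proj_refl]
  · intro I hJ i hi hi' ih x
    have e := ih (X.p i x)
    rw [← h I i hi, Y.proj_p, X.proj_p] at e
    exact e

/-! ### Cores -/

/-- A point lies in the core of the finest common coarsening if it lies in both cores. -/
theorem isCore_sup {r s : Setoid (Fin n)} (hr : IsBlockUnion r I) (hs : IsBlockUnion s I)
    {x : X.obj I} (hxr : X.IsCore r x) (hxs : X.IsCore s x) : X.IsCore (r ⊔ s) x := by
  -- being related by the core condition at `x` is transitive
  have trans : ∀ a ∈ I, ∀ b ∈ I, ∀ c ∈ I, a ≠ b → b ≠ c → a ≠ c →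
      X.p a x = X.zeroAt b (X.p a x) → X.p b x = X.zeroAt c (X.p b x) →
      X.p a x = X.zeroAt c (X.p a x) := by
    intro a ha b hb c hc hab hbc hac h1 h2
    have hbI : b ∈ I.erase a := Finset.mem_erase.2 ⟨hab.symm, hb⟩
    have hcI : c ∈ I.erase a := Finset.mem_erase.2 ⟨hac.symm, hc⟩
    have h3 : X.p b (X.p a x) = X.p b (X.zeroAt c (X.p a x)) := by
      rw [p_zeroAt hbI hcI hbc]
      have e := congrArg (X.proj (J := (I.erase a).erase b)
        (Finset.erase_subset_erase b (Finset.erase_subset a I))) h2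
      have hc' : c ∈ (I.erase a).erase b := Finset.mem_erase.2 ⟨hbc.symm, hcI⟩
      rw [CubeData.zeroAt, X.proj_smul _ hc'] at e
      simpa only [CubeData.p, X.proj_proj, CubeData.zeroAt] using e
    calc X.p a x = X.zeroAt b (X.p a x) := h1
      _ = X.zeroAt b (X.zeroAt c (X.p a x)) := X.zeroAt_eq hbI _ _ h3
      _ = X.zeroAt c (X.zeroAt b (X.p a x)) := X.smul_comm_of_ne hbI hcI hbc 0 0 _
      _ = X.zeroAt c (X.p a x) := by rw [← h1]
  let c : Setoid (Fin n) :=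
    { r := fun a b => (a ∈ I ↔ b ∈ I) ∧ (a ∈ I → a ≠ b →
        X.p a x = X.zeroAt b (X.p a x) ∧ X.p b x = X.zeroAt a (X.p b x))
      iseqv := by
        refine ⟨fun a => ⟨Iff.rfl, fun _ h => absurd rfl h⟩, ?_, ?_⟩
        · rintro a b ⟨h, h'⟩
          exact ⟨h.symm, fun hb hne => (h' (h.2 hb) hne.symm).symm⟩
        · rintro a b c ⟨h1, h1'⟩ ⟨h2, h2'⟩
          refine ⟨h1.trans h2, fun ha hac => ?_⟩
          rcases eq_or_ne a b with rfl | hab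
          · exact h2' ha hac
          rcases eq_or_ne b c with rfl | hbc
          · exact h1' ha hac
          have hb := h1.1 ha
          have hc := h2.1 hb
          obtain ⟨e1, e2⟩ := h1' ha hab
          obtain ⟨e3, e4⟩ := h2' hb hbc
          exact ⟨trans a ha b hb c hc hab hbc hac e1 e3,
            trans c hc b hb a ha hbc.symm hab.symm hac.symm e4 e2⟩ }
  have key : ∀ t : Setoid (Fin n), IsBlockUnion t I → X.IsCore t x → t ≤ c := by
    intro t ht hx a b hab
    refine ⟨⟨ht a b hab, ht b a (t.symm hab)⟩, fun ha hne => ?_⟩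
    have hb := ht a b hab ha
    exact ⟨hx a ha b hb hab hne, hx b hb a ha (t.symm hab) hne.symm⟩
  intro a ha b hb hab hne
  exact ((sup_le (key r hr hxr) (key s hs hxs) hab).2 ha hne).1

theorem isBlockUnion_sup {r s : Setoid (Fin n)} (hr : IsBlockUnion r I)
    (hs : IsBlockUnion s I) : IsBlockUnion (r ⊔ s) I := by
  let c : Setoid (Fin n) :=
    { r := fun a b => a ∈ I ↔ b ∈ I
      iseqv := ⟨fun _ => Iff.rfl, Iff.symm, Iff.trans⟩ }
  have key : ∀ t : Setoid (Fin n), IsBlockUnion t I → t ≤ c :=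
    fun t ht a b hab => ⟨ht a b hab, ht b a (t.symm hab)⟩
  exact fun a b hab ha => (sup_le (key r hr) (key s hs) hab).1 ha

theorem isBlockUnion_of_subset {J : Finset (Fin n)} (h : J ⊆ I) :
    IsBlockUnion (blockPartition J) I := by
  rintro a b (rfl | ⟨_, hb⟩) ha
  exacts [ha, h hb]

section CoreHom

variable {r s : Setoid (Fin n)} (S : CoreHom X Y r)

/-- The value of a core morphism at a point of the ambient bundle that lies in the core. -/
def _root_.CoreHom.app {I : Finset (Fin n)} (hI : IsBlockUnion r I) (x : X.obj I)
    (hx : X.IsCore r x) : Y.obj I :=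
  (S.toFun I hI ⟨x, hx⟩).1

theorem _root_.CoreHom.isCore_app (hI : IsBlockUnion r I) {x : X.obj I} (hx : X.IsCore r x) :
    Y.IsCore r (S.app hI x hx) :=
  (S.toFun I hI ⟨x, hx⟩).2

theorem _root_.CoreHom.app_congr (hI : IsBlockUnion r I) {x y : X.obj I} (h : x = y)
    (hx : X.IsCore r x) (hy : X.IsCore r y) : S.app hI x hx = S.app hI y hy := by
  subst h
  rfl

theorem _root_.CoreHom.proj_app {J : Finset (Fin n)} (hI : IsBlockUnion r I)
    (hJ : IsBlockUnion r J) (h : J ⊆ I) {x : X.obj I} (hx : X.IsCore r x) :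
    Y.proj h (S.app hI x hx) = S.app hJ (X.proj h x) (X.isCore_proj h hx) :=
  congrArg Subtype.val (S.natural hI hJ h ⟨x, hx⟩)

theorem removeBlock_subset_erase (r : Setoid (Fin n)) (I : Finset (Fin n)) (l : Fin n) :
    removeBlock r I l ⊆ I.erase l := by
  classical
  intro k hk
  obtain ⟨hk, hk'⟩ := Finset.mem_filter.1 hk
  exact Finset.mem_erase.2 ⟨fun e => hk' (e ▸ r.refl _), hk⟩

theorem coreProj_removeBlock_congr {x y : X.Core r I} (h : X.p l x.1 = X.p l y.1) :
    coreProj (removeBlock_subset r I l) x = coreProj (removeBlock_subset r I l) y := by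
  refine Subtype.ext ?_
  have e := congrArg (X.proj (removeBlock_subset_erase r I l)) h
  rwa [X.proj_p, X.proj_p] at e

theorem isBlockUnion_removeBlock (hI : IsBlockUnion r I) (l : Fin n) :
    IsBlockUnion r (removeBlock r I l) := by
  classical
  intro a b hab ha
  obtain ⟨ha, ha'⟩ := Finset.mem_filter.1 ha
  exact Finset.mem_filter.2 ⟨hI a b hab ha, fun h => ha' (r.trans h (r.symm hab))⟩

theorem _root_.CoreHom.app_add (hI : IsBlockUnion r I) (hl : l ∈ I) {x y : X.obj I}
    (hx : X.IsCore r x) (hy : X.IsCore r y) (h : X.p l x = X.p l y) :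
    S.app hI (X.add l x y) (X.isCore_add hl hx hy h)
      = Y.add l (S.app hI x hx) (S.app hI y hy) :=
  S.map_add hI hl ⟨x, hx⟩ ⟨y, hy⟩ (coreProj_removeBlock_congr h)

theorem _root_.CoreHom.app_smul (hI : IsBlockUnion r I) (hl : l ∈ I) (t : ℝ) {x : X.obj I}
    (hx : X.IsCore r x) :
    S.app hI (X.smul l t x) (X.isCore_smul hl t hx) = Y.smul l t (S.app hI x hx) :=
  congrArg Subtype.val (S.map_smul hI hl t ⟨x, hx⟩)

theorem _root_.CoreHom.p_app_congr (hI : IsBlockUnion r I) {x y : X.obj I}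
    (hx : X.IsCore r x) (hy : X.IsCore r y) (hl : l ∈ I) (h : X.p l x = X.p l y) :
    Y.p l (S.app hI x hx) = Y.p l (S.app hI y hy) := by
  refine core_fibre hl (x := ⟨S.app hI x hx, S.isCore_app hI hx⟩)
    (y := ⟨S.app hI y hy, S.isCore_app hI hy⟩) (Subtype.ext ?_) (r := r)
  change Y.proj _ _ = Y.proj _ _
  rw [S.proj_app hI (isBlockUnion_removeBlock hI l), S.proj_app hI (isBlockUnion_removeBlock hI l)]
  exact S.app_congr _ (congrArg Subtype.val
    (coreProj_removeBlock_congr (r := r) (x := ⟨x, hx⟩) (y := ⟨y, hy⟩) h)) _ _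

theorem isCore_shift (hi : i ∈ I) (hj : j ∈ I) (hij : i ≠ j) {y t : X.obj I}
    (h : Shiftable i j y t) (hy : X.IsCore r y) (ht : X.IsCore r t) :
    X.IsCore r (X.shift i j y t) :=
  X.isCore_add hi hy (X.isCore_add hj (X.isCore_smul hi 0 hy) ht (h.inner hi hj hij))
    (h.outer hi hj hij)

theorem _root_.CoreHom.app_shift (hI : IsBlockUnion r I) (hi : i ∈ I) (hj : j ∈ I) (hij : i ≠ j)
    {y t : X.obj I} (h : Shiftable i j y t) (hy : X.IsCore r y) (ht : X.IsCore r t) :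
    S.app hI (X.shift i j y t) (isCore_shift hi hj hij h hy ht)
      = Y.shift i j (S.app hI y hy) (S.app hI t ht) := by
  have h0 : X.IsCore r (X.zeroAt i y) := X.isCore_smul hi 0 hy
  have e := S.app_add hI hi hy (X.isCore_add hj h0 ht (h.inner hi hj hij)) (h.outer hi hj hij)
  rw [S.app_add hI hj h0 ht (h.inner hi hj hij)] at e
  change _ = Y.add i _ (Y.add j (Y.zeroAt i _) _)
  rw [← show S.app hI (X.zeroAt i y) h0 = Y.zeroAt i (S.app hI y hy) from
    S.app_smul hI hi 0 hy]
  exact e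

end CoreHom

end MultiBundle

/-! ### The decomposed bundle in components -/

namespace MultiBundle

variable {n : ℕ} {E : MultiBundle.{u} n} {I K L : Finset (Fin n)} {i j k l : Fin n}

theorem add_zeroOver (m : E.obj ∅) (hi : i ∈ K) :
    E.add i (E.zeroOver K m) (E.zeroOver K m) = E.zeroOver K m := by
  conv_lhs => arg 3; rw [E.zeroOver_eq m hi]
  exact zeroAt_add hi _

theorem smul_zeroOver (m : E.obj ∅) (hi : i ∈ K) (t : ℝ) :
    E.smul i t (E.zeroOver K m) = E.zeroOver K m := by
  rw [E.zeroOver_eq m hi, E.smul_zeroAt hi]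

theorem zeroOver_empty (m : E.obj ∅) : E.zeroOver ∅ m = m := by
  conv_rhs => rw [← E.proj_zeroOver ∅ m]
  rw [E.proj_refl]

/-- An element over `m` that is zero in all directions is `0_m`. -/
theorem eq_zeroOver {x : E.obj K} (h : ∀ k ∈ K, x = E.zeroAt k x) :
    x = E.zeroOver K (E.proj (Finset.empty_subset K) x) :=
  E.zero_unique K (Finset.empty_subset K) _ _ (fun k hk _ => h k hk)
    (fun _ hk _ => E.zeroOver_eq _ hk) (E.proj_zeroOver _ _).symm

theorem zeroAt_eq_zeroOver {x : E.obj K} (hx : E.IsCore ⊤ x) (hi : i ∈ K) :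
    E.zeroAt i x = E.zeroOver K (E.proj (Finset.empty_subset K) x) := by
  rw [← proj_empty_smul hi 0 x]
  refine eq_zeroOver fun k hk => ?_
  rcases eq_or_ne k i with rfl | hki
  · rw [zeroAt_zeroAt hk]
  · rw [show E.zeroAt k (E.zeroAt i x) = E.zeroAt i (E.zeroAt k x) from
      E.smul_comm_of_ne hk hi hki 0 0 x]
    refine E.zeroAt_eq hi _ _ ?_
    rw [p_zeroAt hi hk hki.symm]
    exact hx i hi k hk trivial hki.symm

/-- The component in the building bundle `E^K_K` of an element of `E^dec(I)`, for `K ⊆ I`. -/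
def comp (x : E.dec.obj I) (K : Finset (Fin n)) (hK : K ⊆ I) : E.obj K :=
  decompComp (h0 := Set.mem_univ _) x K hK (Set.mem_univ K)

/-- The base point in `M` of an element of `E^dec(I)`. -/
def base (x : E.dec.obj I) : E.obj ∅ := comp x ∅ (Finset.empty_subset I)

theorem dec_ext {x y : E.dec.obj I} (h : ∀ K hK, comp x K hK = comp y K hK) : x = y :=
  Subtype.ext (funext fun K => funext fun hK => funext fun _ => h K hK)

theorem isCore_comp (x : E.dec.obj I) (hK : K ⊆ I) : E.IsCore ⊤ (comp x K hK) :=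
  (x.2 K hK (Set.mem_univ K)).1

theorem proj_comp (x : E.dec.obj I) (hK : K ⊆ I) :
    E.proj (Finset.empty_subset K) (comp x K hK) = base x :=
  (x.2 K hK (Set.mem_univ K)).2

theorem comp_smul_of_mem (x : E.dec.obj I) (t : ℝ) (hK : K ⊆ I) (hi : i ∈ K) :
    comp (E.dec.smul i t x) K hK = E.smul i t (comp x K hK) := if_pos hi

theorem comp_smul_of_notMem (x : E.dec.obj I) (t : ℝ) (hK : K ⊆ I) (hi : i ∉ K) :
    comp (E.dec.smul i t x) K hK = comp x K hK := if_neg hi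

theorem comp_add_of_mem {x y : E.dec.obj I} (h : E.dec.p i x = E.dec.p i y) (hK : K ⊆ I)
    (hi : i ∈ K) : comp (E.dec.add i x y) K hK = E.add i (comp x K hK) (comp y K hK) :=
  (decompAdd_val h K hK _).trans (if_pos hi)

theorem comp_add_of_notMem {x y : E.dec.obj I} (h : E.dec.p i x = E.dec.p i y) (hK : K ⊆ I)
    (hi : i ∉ K) : comp (E.dec.add i x y) K hK = comp x K hK :=
  (decompAdd_val h K hK _).trans (if_neg hi)

theorem comp_zeroAt_of_mem (x : E.dec.obj I) (hK : K ⊆ I) (hi : i ∈ K) :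
    comp (E.dec.zeroAt i x) K hK = E.zeroOver K (base x) := by
  rw [← proj_comp x hK, ← zeroAt_eq_zeroOver (isCore_comp x hK) hi]
  exact comp_smul_of_mem x 0 hK hi

theorem comp_zeroAt_of_notMem (x : E.dec.obj I) (hK : K ⊆ I) (hi : i ∉ K) :
    comp (E.dec.zeroAt i x) K hK = comp x K hK := comp_smul_of_notMem x 0 hK hi

theorem base_add {x y : E.dec.obj I} (h : E.dec.p i x = E.dec.p i y) :
    base (E.dec.add i x y) = base x := comp_add_of_notMem h _ (Finset.notMem_empty i)

theorem base_smul (x : E.dec.obj I) (t : ℝ) : base (E.dec.smul i t x) = base x :=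
  comp_smul_of_notMem x t _ (Finset.notMem_empty i)

theorem base_congr {x y : E.dec.obj I} (h : E.dec.p i x = E.dec.p i y) : base x = base y :=
  congrArg (base (I := I.erase i)) h

theorem comp_congr {x y : E.dec.obj I} (h : E.dec.p i x = E.dec.p i y) (hK : K ⊆ I)
    (hi : i ∉ K) : comp x K hK = comp y K hK :=
  congrArg (fun z => comp z K (Finset.subset_erase.2 ⟨hK, hi⟩)) h

theorem p_comp_congr {x y : E.dec.obj I} (h : E.dec.p i x = E.dec.p i y) (hK : K ⊆ I)
    (hi : i ∈ K) : E.p i (comp x K hK) = E.p i (comp y K hK) :=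
  E.p_eq_of_isCore_top hi (isCore_comp x hK) (isCore_comp y hK)
    ((proj_comp x hK).trans ((base_congr h).trans (proj_comp y hK).symm))

theorem comp_add_zeroOver (x : E.dec.obj I) (hK : K ⊆ I) (hi : i ∈ K) :
    E.add i (comp x K hK) (E.zeroOver K (base x)) = comp x K hK := by
  rw [← proj_comp x hK, ← zeroAt_eq_zeroOver (isCore_comp x hK) hi, E.add_zeroAt hi]

theorem zeroOver_add_comp (x : E.dec.obj I) (hK : K ⊆ I) (hi : i ∈ K) :
    E.add i (E.zeroOver K (base x)) (comp x K hK) = comp x K hK := by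
  rw [← proj_comp x hK, ← zeroAt_eq_zeroOver (isCore_comp x hK) hi, zeroAt_add hi]

/-- An element of `E^dec(I)` lies in the core defined by `r` iff its components in `E^K_K` vanish
for all `K` that are not unions of blocks (relative to `I`). -/
theorem dec_isCore_iff {r : Setoid (Fin n)} {x : E.dec.obj I} :
    E.dec.IsCore r x ↔ ∀ K (hK : K ⊆ I), ∀ j ∈ I, ∀ k ∈ K, r j k → j ∉ K →
      comp x K hK = E.zeroOver K (base x) := by
  constructor
  · intro h K hK j hj k hk hjk hjK
    have hne : j ≠ k := fun e => hjK (e ▸ hk)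
    have e := congrArg (fun z => comp z K (Finset.subset_erase.2 ⟨hK, hjK⟩))
      (h j hj k (hK hk) hjk hne)
    exact e.trans (comp_zeroAt_of_mem _ _ hk)
  · intro h j hj k hk hjk hne
    refine dec_ext fun K hK => ?_
    obtain ⟨hK', hjK⟩ := Finset.subset_erase.1 hK
    by_cases hkK : k ∈ K
    · rw [comp_zeroAt_of_mem _ _ hkK]
      exact h K hK' j hj k hkK hjk hjK
    · rw [comp_zeroAt_of_notMem _ _ hkK]

open Classical in
/-- The element of `E^dec(I)` obtained from `x` by replacing the components in the building bundles
`E^K_K` with `K ∉ P` by zero. -/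
noncomputable def trunc (P : Set (Finset (Fin n))) (x : E.dec.obj I) : E.dec.obj I :=
  (⟨fun K hK _ => if K ∈ P then comp x K hK else E.zeroOver K (base x), by
    intro K hK _
    have e : (if ∅ ∈ P then comp x ∅ (Finset.empty_subset I) else E.zeroOver ∅ (base x))
        = base x := by
      split_ifs
      · rfl
      · exact zeroOver_empty _
    beta_reduce
    rw [e]
    split_ifs
    · exact ⟨isCore_comp x hK, proj_comp x hK⟩
    · exact ⟨E.isCore_zeroOver _ _ _, E.proj_zeroOver _ _⟩⟩ :
    E.DecompObj Set.univ (Set.mem_univ _) I)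

section trunc

variable {P Q : Set (Finset (Fin n))} (x : E.dec.obj I)

theorem comp_trunc_of_mem (hK : K ⊆ I) (h : K ∈ P) :
    comp (trunc P x) K hK = comp x K hK := if_pos h

theorem comp_trunc_of_notMem (hK : K ⊆ I) (h : K ∉ P) :
    comp (trunc P x) K hK = E.zeroOver K (base x) := if_neg h

theorem base_trunc : base (trunc P x) = base x := by
  by_cases h : ∅ ∈ P
  · exact comp_trunc_of_mem x _ h
  · exact (comp_trunc_of_notMem x _ h).trans (zeroOver_empty _)

theorem trunc_eq_self (h : ∀ K (hK : K ⊆ I), K ∉ P → comp x K hK = E.zeroOver K (base x)) :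
    trunc P x = x := by
  refine dec_ext fun K hK => ?_
  by_cases hP : K ∈ P
  · exact comp_trunc_of_mem x hK hP
  · rw [comp_trunc_of_notMem x hK hP, h K hK hP]

theorem trunc_univ : trunc Set.univ x = x :=
  trunc_eq_self x fun K _ h => absurd (Set.mem_univ K) h

/-- Truncations agree if the components in the symmetric difference vanish. -/
theorem trunc_congr (h : ∀ K (hK : K ⊆ I), ¬(K ∈ P ↔ K ∈ Q) →
    comp x K hK = E.zeroOver K (base x)) : trunc P x = trunc Q x := by
  refine dec_ext fun K hK => ?_
  by_cases hP : K ∈ P <;> by_cases hQ : K ∈ Q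
  · rw [comp_trunc_of_mem x hK hP, comp_trunc_of_mem x hK hQ]
  · rw [comp_trunc_of_mem x hK hP, comp_trunc_of_notMem x hK hQ, h K hK (by tauto)]
  · rw [comp_trunc_of_notMem x hK hP, comp_trunc_of_mem x hK hQ, h K hK (by tauto)]
  · rw [comp_trunc_of_notMem x hK hP, comp_trunc_of_notMem x hK hQ]

theorem trunc_trunc (h : P ⊆ Q) : trunc P (trunc Q x) = trunc P x := by
  refine dec_ext fun K hK => ?_
  by_cases hP : K ∈ P
  · rw [comp_trunc_of_mem _ hK hP, comp_trunc_of_mem _ hK hP, comp_trunc_of_mem _ hK (h hP)]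
  · rw [comp_trunc_of_notMem _ hK hP, comp_trunc_of_notMem _ hK hP, base_trunc]

theorem proj_trunc (hL : L ⊆ I) :
    E.dec.proj hL (trunc P x) = trunc P (E.dec.proj hL x) := rfl

theorem p_trunc_congr {x y : E.dec.obj I} (h : E.dec.p i x = E.dec.p i y) :
    E.dec.p i (trunc P x) = E.dec.p i (trunc P y) :=
  congrArg (trunc P) h

theorem trunc_add {x y : E.dec.obj I} (h : E.dec.p i x = E.dec.p i y) :
    trunc P (E.dec.add i x y) = E.dec.add i (trunc P x) (trunc P y) := by
  have h' : E.dec.p i (trunc P x) = E.dec.p i (trunc P y) := p_trunc_congr h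
  refine dec_ext fun K hK => ?_
  by_cases hi : i ∈ K <;> by_cases hP : K ∈ P
  · rw [comp_add_of_mem h' hK hi, comp_trunc_of_mem _ hK hP, comp_add_of_mem h hK hi,
      comp_trunc_of_mem _ hK hP, comp_trunc_of_mem _ hK hP]
  · rw [comp_add_of_mem h' hK hi, comp_trunc_of_notMem _ hK hP, comp_trunc_of_notMem _ hK hP,
      comp_trunc_of_notMem _ hK hP, base_add h, base_congr h, add_zeroOver _ hi]
  · rw [comp_add_of_notMem h' hK hi, comp_trunc_of_mem _ hK hP, comp_add_of_notMem h hK hi,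
      comp_trunc_of_mem _ hK hP]
  · rw [comp_add_of_notMem h' hK hi, comp_trunc_of_notMem _ hK hP, comp_trunc_of_notMem _ hK hP,
      base_add h]

theorem trunc_smul (t : ℝ) :
    trunc P (E.dec.smul i t x) = E.dec.smul i t (trunc P x) := by
  refine dec_ext fun K hK => ?_
  by_cases hi : i ∈ K <;> by_cases hP : K ∈ P
  · rw [comp_smul_of_mem _ t hK hi, comp_trunc_of_mem _ hK hP, comp_smul_of_mem _ t hK hi,
      comp_trunc_of_mem _ hK hP]
  · rw [comp_smul_of_mem _ t hK hi, comp_trunc_of_notMem _ hK hP, comp_trunc_of_notMem _ hK hP,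
      base_smul, smul_zeroOver _ hi]
  · rw [comp_smul_of_notMem _ t hK hi, comp_trunc_of_mem _ hK hP, comp_smul_of_notMem _ t hK hi,
      comp_trunc_of_mem _ hK hP]
  · rw [comp_smul_of_notMem _ t hK hi, comp_trunc_of_notMem _ hK hP,
      comp_trunc_of_notMem _ hK hP, base_smul]

theorem isCore_trunc {r : Setoid (Fin n)} {x : E.dec.obj I} (hx : E.dec.IsCore r x) :
    E.dec.IsCore r (trunc P x) := by
  rw [dec_isCore_iff] at hx ⊢
  intro K hK j hj k hk hjk hjK
  rw [base_trunc]
  by_cases hP : K ∈ P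
  · rw [comp_trunc_of_mem _ hK hP]
    exact hx K hK j hj k hk hjk hjK
  · exact comp_trunc_of_notMem _ hK hP

variable (P) in
/-- The collection consisting of `K` and of the members of `P` that contain neither `i` nor `j`. -/
def avoiding (K : Finset (Fin n)) (i j : Fin n) : Set (Finset (Fin n)) :=
  insert K {L ∈ P | i ∉ L ∧ j ∉ L}

theorem avoiding_subset : avoiding P K i j ⊆ insert K P :=
  Set.insert_subset_insert fun _ h => h.1

theorem mem_avoiding : L ∈ avoiding P K i j ↔ L = K ∨ L ∈ P ∧ i ∉ L ∧ j ∉ L := Iff.rfl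

theorem isCore_trunc_avoiding (hi : i ∈ K) (hj : j ∈ K) :
    E.dec.IsCore (blockPartition {i, j}) (trunc (avoiding P K i j) x) := by
  rw [dec_isCore_iff]
  rintro L hL a ha b hb (rfl | ⟨ha', hb'⟩) haL
  · exact absurd hb haL
  rw [base_trunc]
  refine comp_trunc_of_notMem _ hL fun hP => ?_
  simp only [Finset.mem_insert, Finset.mem_singleton] at ha' hb'
  rcases mem_avoiding.1 hP with rfl | ⟨_, h1, h2⟩
  · rcases ha' with rfl | rfl <;> contradiction
  · rcases hb' with rfl | rfl <;> contradiction

theorem shiftable_trunc (hi : i ∈ K) (hj : j ∈ K) :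
    Shiftable i j (trunc P x) (trunc (avoiding P K i j) x) := by
  constructor
  · refine dec_ext fun L hL => ?_
    obtain ⟨hL', hiL⟩ := Finset.subset_erase.1 hL
    have hLK : L ≠ K := fun e => hiL (e ▸ hi)
    by_cases hjL : j ∈ L
    · rw [comp_zeroAt_of_mem _ hL hjL]
      refine (comp_trunc_of_notMem x hL' ?_).trans (congrArg _ (base_trunc x).symm)
      simp [mem_avoiding, hLK, hjL]
    · rw [comp_zeroAt_of_notMem _ hL hjL]
      by_cases hP : L ∈ P
      · exact (comp_trunc_of_mem x hL' (mem_avoiding.2 (Or.inr ⟨hP, hiL, hjL⟩))).trans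
          (comp_trunc_of_mem x hL' hP).symm
      · exact (comp_trunc_of_notMem x hL' (by simp [mem_avoiding, hLK, hP])).trans
          (comp_trunc_of_notMem x hL' hP).symm
  · refine dec_ext fun L hL => ?_
    obtain ⟨hL', hjL⟩ := Finset.subset_erase.1 hL
    have hLK : L ≠ K := fun e => hjL (e ▸ hj)
    by_cases hiL : i ∈ L
    · rw [comp_zeroAt_of_mem _ hL hiL]
      refine (comp_trunc_of_notMem x hL' ?_).trans (congrArg _ (base_trunc x).symm)
      simp [mem_avoiding, hLK, hiL]
    · rw [comp_zeroAt_of_notMem _ hL hiL]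
      by_cases hP : L ∈ P
      · exact (comp_trunc_of_mem x hL' (mem_avoiding.2 (Or.inr ⟨hP, hiL, hjL⟩))).trans
          (comp_trunc_of_mem x hL' hP).symm
      · exact (comp_trunc_of_notMem x hL' (by simp [mem_avoiding, hLK, hP])).trans
          (comp_trunc_of_notMem x hL' hP).symm

/-- Adding the component in `E^K_K` to an element of `E^dec(I)` is a shift by an element of the
core defined by two directions of `K`. -/
theorem trunc_insert (hi : i ∈ K) (hj : j ∈ K) (hij : i ≠ j) (hK : K ⊆ I) (hP : K ∉ P) :
    trunc (insert K P) x = E.dec.shift i j (trunc P x) (trunc (avoiding P K i j) x) := by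
  have h := shiftable_trunc (P := P) x hi hj
  have hi' := hK hi
  have hj' := hK hj
  have h1 := h.inner hi' hj' hij
  have h2 := h.outer hi' hj' hij
  refine dec_ext fun L hL => ?_
  rw [shift]
  by_cases hiL : i ∈ L
  · rw [comp_add_of_mem h2 hL hiL]
    by_cases hjL : j ∈ L
    · rw [comp_add_of_mem h1 hL hjL, comp_zeroAt_of_mem _ hL hiL, base_trunc]
      by_cases hLK : L = K
      · subst hLK
        rw [comp_trunc_of_notMem x hL hP, comp_trunc_of_mem x hL (Set.mem_insert _ _),
          comp_trunc_of_mem x hL (mem_avoiding.2 (Or.inl rfl)), zeroOver_add_comp x hL hjL,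
          zeroOver_add_comp x hL hiL]
      · rw [comp_trunc_of_notMem (P := avoiding P K i j) x hL
          (by simp [mem_avoiding, hLK, hiL]), add_zeroOver _ hjL]
        by_cases hLP : L ∈ P
        · rw [comp_trunc_of_mem x hL (Set.mem_insert_of_mem _ hLP), comp_trunc_of_mem x hL hLP,
            comp_add_zeroOver x hL hiL]
        · rw [comp_trunc_of_notMem x hL (by simp [hLK, hLP]), comp_trunc_of_notMem x hL hLP,
            add_zeroOver _ hiL]
    · have hLK : L ≠ K := fun e => hjL (e ▸ hj)
      rw [comp_add_of_notMem h1 hL hjL, comp_zeroAt_of_mem _ hL hiL, base_trunc]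
      by_cases hLP : L ∈ P
      · rw [comp_trunc_of_mem x hL (Set.mem_insert_of_mem _ hLP), comp_trunc_of_mem x hL hLP,
          comp_add_zeroOver x hL hiL]
      · rw [comp_trunc_of_notMem x hL (by simp [hLK, hLP]), comp_trunc_of_notMem x hL hLP,
          add_zeroOver _ hiL]
  · have hLK : L ≠ K := fun e => hiL (e ▸ hi)
    rw [comp_add_of_notMem h2 hL hiL]
    by_cases hLP : L ∈ P
    · rw [comp_trunc_of_mem x hL (Set.mem_insert_of_mem _ hLP), comp_trunc_of_mem x hL hLP]
    · rw [comp_trunc_of_notMem x hL (by simp [hLK, hLP]), comp_trunc_of_notMem x hL hLP]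

theorem trunc_avoiding_eq_zeroAt 
    (h : ∀ hK : K ⊆ I, comp x K hK = E.zeroOver K (base x)) :
    trunc (avoiding P K i j) x = E.dec.zeroAt j (trunc (avoiding P K i j) x) := by
  refine dec_ext fun L hL => ?_
  by_cases hjL : j ∈ L
  · rw [comp_zeroAt_of_mem _ hL hjL, base_trunc]
    by_cases hLK : L = K
    · subst hLK
      rw [comp_trunc_of_mem x hL (mem_avoiding.2 (Or.inl rfl)), h hL]
    · exact comp_trunc_of_notMem x hL (by simp [mem_avoiding, hLK, hjL])
  · rw [comp_zeroAt_of_notMem _ hL hjL]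

end trunc

theorem trunc_insert_of_not_subset {P : Set (Finset (Fin n))} (x : E.dec.obj I) (hK : ¬K ⊆ I) :
    trunc (insert K P) x = trunc P x := by
  refine trunc_congr x fun L hL h => absurd ?_ h
  have : L ≠ K := fun e => hK (e ▸ hL)
  simp [this]

/-! ### The vacant decomposed bundle -/

/-- The truncation `E^dec(I) → vacant(I)` that forgets the components in the building bundles
`E^K_K` with `#K ≥ 2`. -/
def forget (x : E.dec.obj I) : E.vacant.obj I :=
  (⟨fun K hK _ => comp x K hK, fun _ hK _ => ⟨isCore_comp x hK, proj_comp x hK⟩⟩ :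
    E.DecompObj {K | K.card ≤ 1} (Nat.zero_le 1) I)

theorem ι_forget (x : E.dec.obj I) : E.ι I (forget x) = trunc {K | K.card ≤ 1} x := by
  refine dec_ext fun K hK => ?_
  by_cases h : K.card ≤ 1
  · exact (dif_pos h).trans (comp_trunc_of_mem x hK h).symm
  · exact (dif_neg h).trans (comp_trunc_of_notMem x hK h).symm

theorem forget_ι (x : E.vacant.obj I) : forget (E.ι I x) = x :=
  Subtype.ext (funext fun _ => funext fun _ => funext fun hP => dif_pos hP)

theorem trunc_ι (x : E.vacant.obj I) : trunc {K | K.card ≤ 1} (E.ι I x) = E.ι I x := by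
  rw [← ι_forget, forget_ι]

theorem forget_trunc {P : Set (Finset (Fin n))} (hP : {K | K.card ≤ 1} ⊆ P) (x : E.dec.obj I) :
    forget (trunc P x) = forget x :=
  Subtype.ext (funext fun _ => funext fun hK => funext fun h => comp_trunc_of_mem x hK (hP h))

theorem forget_add {x y : E.dec.obj I} (h : E.dec.p i x = E.dec.p i y) :
    forget (E.dec.add i x y) = E.vacant.add i (forget x) (forget y) := by
  have h' : E.vacant.p i (forget x) = E.vacant.p i (forget y) := congrArg forget h
  refine Subtype.ext (funext fun K => funext fun hK => funext fun hP => ?_)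
  exact (decompAdd_val h K hK _).trans (decompAdd_val h' K hK _).symm

end MultiBundle

/-! ### Smoothness of the fibrewise operations -/

namespace NFoldVectorBundle

variable {n : ℕ} (E : NFoldVectorBundle.{u} n) {I : Finset (Fin n)} {i : Fin n} {m : ℕ}

/-- Local criterion for the smoothness of a map `d` into the total space of
`p_i : E(I) → E(I \ {i})` that covers the same map as a smooth map `c`: near each point, the fibre
component of `d` in a linear trivialisation has to be smooth. Here `φ` stands for the fibre
component of a trivialisation over a neighbourhood of `p_i (c u₀)`, of which `s` is the preimage;
only its linearity and its smoothness along lifts of `p_i ∘ c` are made available. -/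
theorem isPlot_of_trivialization (hi : i ∈ I) {c d : EuclideanSpace ℝ (Fin m) → E.obj I}
    (hc : @IsPlot _ (E.diffeology I) m c) (hp : ∀ u, E.p i (d u) = E.p i (c u))
    (h : ∀ (u₀ : EuclideanSpace ℝ (Fin m)) (k : ℕ) (φ : E.obj I → EuclideanSpace ℝ (Fin k))
      (s : Set (EuclideanSpace ℝ (Fin m))), IsOpen s → u₀ ∈ s →
      (∀ e : EuclideanSpace ℝ (Fin m) → E.obj I, @IsPlot _ (E.diffeology I) m e →
        (∀ u, E.p i (e u) = E.p i (c u)) → ContDiffAt ℝ ∞ (fun u => φ (e u)) u₀) →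
      (∀ u ∈ s, ∀ x y : E.obj I, E.p i x = E.p i (c u) → E.p i y = E.p i (c u) →
        φ (E.add i x y) = φ x + φ y) →
      (∀ u ∈ s, ∀ (t : ℝ) (x : E.obj I), E.p i x = E.p i (c u) →
        φ (E.smul i t x) = t • φ x) →
      ∃ f : EuclideanSpace ℝ (Fin m) → EuclideanSpace ℝ (Fin k),
        ContDiffAt ℝ ∞ f u₀ ∧ ∀ u ∈ s, φ (d u) = f u) :
    @IsPlot _ (E.diffeology I) m d := by
  let _ := E.topology
  let _ := E.charted
  have _ := E.manifold
  rw [E.isPlot_iff] at hc ⊢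
  intro u₀
  obtain ⟨k, hk⟩ := E.locally_trivial I i hi
  obtain ⟨φ, hb, hφ, hφs, hadd, hsmul⟩ := hk (E.p i (c u₀))
  have hpc : ContMDiff (𝓡 m) (𝓡 (E.dim (I.erase i))) ∞ (fun u => E.p i (c u)) :=
    (E.smooth_proj (Finset.erase_subset i I)).comp hc
  have hs : IsOpen ((fun u => E.p i (c u)) ⁻¹' φ.baseSet) :=
    φ.open_baseSet.preimage hpc.continuous
  obtain ⟨f, hf, hdf⟩ := h u₀ k (fun x => (φ x).2) _ hs hb
    (by
      intro e he hpe
      rw [E.isPlot_iff] at he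
      have hmem : e u₀ ∈ φ.source := φ.mem_source.2 (by rw [hpe]; exact hb)
      have h1 : ContMDiffAt (𝓡 (E.dim I)) ((𝓡 (E.dim (I.erase i))).prod (𝓡 k)) ∞ φ (e u₀) :=
        hφ.contMDiffAt (φ.open_source.mem_nhds hmem)
      have h2 := h1.comp u₀ (he u₀)
      exact h2.snd.contDiffAt)
    (by
      intro u hu x y hx hy
      exact hadd x (φ.mem_source.2 (by rw [hx]; exact hu)) y
        (φ.mem_source.2 (by rw [hy]; exact hu)) (hx.trans hy.symm))
    (by
      intro u hu t x hx
      exact hsmul x (φ.mem_source.2 (by rw [hx]; exact hu)) t)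
  have hmem : d u₀ ∈ φ.source := φ.mem_source.2 (by rw [hp]; exact hb)
  have hev : d =ᶠ[nhds u₀] fun u => φ.toOpenPartialHomeomorph.symm (E.p i (c u), f u) := by
    filter_upwards [hs.mem_nhds hb] with u hu
    have hu' : d u ∈ φ.source := φ.mem_source.2 (by rw [hp]; exact hu)
    have e : φ (d u) = (E.p i (c u), f u) :=
      Prod.ext ((φ.coe_fst hu').trans (hp u)) (hdf u hu)
    rw [← e]
    exact (φ.toOpenPartialHomeomorph.left_inv hu').symm
  refine ContMDiffAt.congr_of_eventuallyEq ?_ hev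
  have ht : (E.p i (c u₀), f u₀) ∈ φ.target := φ.mem_target.2 hb
  have h1 := (hφs.contMDiffAt (φ.open_target.mem_nhds ht))
  exact h1.comp u₀ (hpc.contMDiffAt.prodMk hf.contMDiffAt)

theorem isPlot_add (hi : i ∈ I) {c d : EuclideanSpace ℝ (Fin m) → E.obj I}
    (hc : @IsPlot _ (E.diffeology I) m c) (hd : @IsPlot _ (E.diffeology I) m d)
    (h : ∀ u, E.p i (c u) = E.p i (d u)) :
    @IsPlot _ (E.diffeology I) m (fun u => E.add i (c u) (d u)) := by
  refine E.isPlot_of_trivialization hi hc (fun u => E.p_add_self hi _ _ (h u)) ?_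
  intro u₀ k φ s _ _ hφ hadd _
  exact ⟨fun u => φ (c u) + φ (d u), (hφ c hc fun _ => rfl).add (hφ d hd fun u => (h u).symm),
    fun u hu => hadd u hu _ _ rfl (h u).symm⟩

theorem isPlot_smul (hi : i ∈ I) (t : ℝ) {c : EuclideanSpace ℝ (Fin m) → E.obj I}
    (hc : @IsPlot _ (E.diffeology I) m c) :
    @IsPlot _ (E.diffeology I) m (fun u => E.smul i t (c u)) := by
  refine E.isPlot_of_trivialization hi hc (fun u => E.p_smul_self hi _ _) ?_
  intro u₀ k φ s _ _ hφ _ hsmul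
  exact ⟨fun u => t • φ (c u), (hφ c hc fun _ => rfl).const_smul t,
    fun u hu => hsmul u hu t _ rfl⟩

theorem isPlot_proj {J : Finset (Fin n)} (h : J ⊆ I) {c : EuclideanSpace ℝ (Fin m) → E.obj I}
    (hc : @IsPlot _ (E.diffeology I) m c) :
    @IsPlot _ (E.diffeology J) m (fun u => E.proj h (c u)) := by
  let _ := E.topology
  let _ := E.charted
  rw [E.isPlot_iff] at hc ⊢
  exact (E.smooth_proj h).comp hc

/-- Iterated zero sections are smooth. -/
theorem isPlot_zeroOver {c : EuclideanSpace ℝ (Fin m) → E.obj I}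
    (hc : @IsPlot _ (E.diffeology I) m c) :
    @IsPlot _ (E.diffeology I) m
      (fun u => E.zeroOver I (E.proj (Finset.empty_subset I) (c u))) := by
  have key : ∀ A : Finset (Fin n), A ⊆ I → ∃ d : EuclideanSpace ℝ (Fin m) → E.obj I,
      @IsPlot _ (E.diffeology I) m d ∧ (∀ u, ∀ k ∈ A, d u = E.zeroAt k (d u)) ∧
      ∀ u, E.proj (Finset.empty_subset I) (d u) = E.proj (Finset.empty_subset I) (c u) := by
    intro A
    induction A using Finset.induction with
    | empty => exact fun _ => ⟨c, hc, by simp, fun _ => rfl⟩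
    | insert a A _ ih =>
      intro hA
      have ha : a ∈ I := hA (Finset.mem_insert_self a A)
      obtain ⟨d, hd, hz, hp⟩ := ih ((Finset.subset_insert a A).trans hA)
      refine ⟨fun u => E.zeroAt a (d u), E.isPlot_smul ha 0 hd, ?_, ?_⟩
      · intro u k hk
        rcases Finset.mem_insert.1 hk with rfl | hkA
        · exact (MultiBundle.zeroAt_zeroAt ha _).symm
        · beta_reduce
          conv_lhs => rw [hz u k hkA]
          exact MultiBundle.smul_comm_any ha (hA hk) 0 0 _
      · exact fun u => (MultiBundle.proj_empty_smul ha 0 _).trans (hp u)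
  obtain ⟨d, hd, hz, hp⟩ := key I (Finset.Subset.refl I)
  have e : d = fun u => E.zeroOver I (E.proj (Finset.empty_subset I) (c u)) := by
    funext u
    rw [← hp u]
    exact MultiBundle.eq_zeroOver (hz u)
  exact e ▸ hd

theorem isPlot_shift {j : Fin n} (hi : i ∈ I) (hj : j ∈ I) (hij : i ≠ j)
    {c d : EuclideanSpace ℝ (Fin m) → E.obj I} (hc : @IsPlot _ (E.diffeology I) m c)
    (hd : @IsPlot _ (E.diffeology I) m d)
    (h : ∀ u, MultiBundle.Shiftable (X := E.toMultiBundle) i j (c u) (d u)) :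
    @IsPlot _ (E.diffeology I) m (fun u => E.shift i j (c u) (d u)) :=
  E.isPlot_add hi hc (E.isPlot_add hj (E.isPlot_smul hi 0 hc) hd
    fun u => (h u).inner hi hj hij) fun u => (h u).outer hi hj hij

/-- The plots of `E^dec(I)` are the maps with smooth components. -/
theorem isPlot_dec_iff {c : EuclideanSpace ℝ (Fin m) → E.dec.obj I} :
    @IsPlot _ (E.dec.diffeology I) m c ↔
      ∀ K (hK : K ⊆ I), @IsPlot _ (E.diffeology K) m (fun u => MultiBundle.comp (c u) K hK) :=
  ⟨fun h K hK => h ⟨K, hK, Set.mem_univ K⟩, fun h K => h K.1 K.2.1⟩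

/-- A truncation is smooth if the components that are kept are smooth. The other components are zero
vectors over the base point, which is only required to be covered by some smooth map. -/
theorem isPlot_trunc_of_comp (P : Set (Finset (Fin n))) {c : EuclideanSpace ℝ (Fin m) → E.dec.obj I}
    (hc : ∀ K (hK : K ⊆ I), K ∈ P →
      @IsPlot _ (E.diffeology K) m (fun u => MultiBundle.comp (c u) K hK))
    (h : ∀ K (_ : K ⊆ I), K ∉ P → ∃ d : EuclideanSpace ℝ (Fin m) → E.obj K,
      @IsPlot _ (E.diffeology K) m d ∧
        ∀ u, E.proj (Finset.empty_subset K) (d u) = MultiBundle.base (c u)) :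
    @IsPlot _ (E.dec.diffeology I) m (fun u => MultiBundle.trunc P (c u)) := by
  rw [isPlot_dec_iff]
  intro K hK
  by_cases hP : K ∈ P
  · simp only [MultiBundle.comp_trunc_of_mem _ hK hP]
    exact hc K hK hP
  · simp only [MultiBundle.comp_trunc_of_notMem _ hK hP]
    obtain ⟨d, hd, hp⟩ := h K hK hP
    simp only [← hp]
    exact E.isPlot_zeroOver hd

theorem isPlot_trunc (P : Set (Finset (Fin n))) {c : EuclideanSpace ℝ (Fin m) → E.dec.obj I}
    (hc : @IsPlot _ (E.dec.diffeology I) m c) :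
    @IsPlot _ (E.dec.diffeology I) m (fun u => MultiBundle.trunc P (c u)) := by
  rw [isPlot_dec_iff] at hc
  exact E.isPlot_trunc_of_comp P (fun K hK _ => hc K hK)
    fun K hK _ => ⟨_, hc K hK, fun u => MultiBundle.proj_comp (c u) hK⟩

theorem isPlot_forget {c : EuclideanSpace ℝ (Fin m) → E.dec.obj I}
    (hc : @IsPlot _ (E.dec.diffeology I) m c) :
    @IsPlot _ (E.vacant.diffeology I) m (fun u => MultiBundle.forget (c u)) :=
  fun K => hc ⟨K.1, K.2.1, Set.mem_univ _⟩

end NFoldVectorBundle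

/-! ### Partial decompositions -/

namespace NFoldVectorBundle

open MultiBundle

variable {n : ℕ} {E : NFoldVectorBundle.{u} n} {I K : Finset (Fin n)} {i j : Fin n}

/-- The data `σ` (a linear splitting) and `T` (decompositions of the highest order cores) are
realised by the morphism `S : E^dec → E` on the elements all of whose components in the `E^K_K` with
`K ∉ P` vanish.  On the other elements, `S` takes the value at their truncation. -/
structure IsPartialDecomposition (σ : MultiHom E.vacant E.toMultiBundle)
    (T : ∀ J : Finset (Fin n), J.card = 2 → CoreHom E.dec E.toMultiBundle (blockPartition J))
    (P : Set (Finset (Fin n))) (S : MultiHom E.dec E.toMultiBundle) : Prop where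
  apply_trunc : ∀ {I : Finset (Fin n)} (x : E.dec.obj I), S.toFun I (trunc P x) = S.toFun I x
  apply_ι : ∀ {I : Finset (Fin n)} (x : E.vacant.obj I), S.toFun I (E.ι I x) = σ.toFun I x
  apply_core : ∀ {J : Finset (Fin n)} (hJ : J.card = 2) {I : Finset (Fin n)}
    (hI : IsBlockUnion (blockPartition J) I) {x : E.dec.obj I}
    (hx : E.dec.IsCore (blockPartition J) x),
    S.toFun I x = (T J hJ).app hI (trunc P x) (isCore_trunc hx)

theorem app_eq_of_compatible {r s : Setoid (Fin n)}
    {S : CoreHom E.dec E.toMultiBundle r} {T : CoreHom E.dec E.toMultiBundle s}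
    (h : Compatible S T) (hr : IsBlockUnion r I) (hs : IsBlockUnion s I) {x : E.dec.obj I}
    (hxr : E.dec.IsCore r x) (hxs : E.dec.IsCore s x) : S.app hr x hxr = T.app hs x hxs :=
  h I (isBlockUnion_sup hr hs) ⟨x, isCore_sup hr hs hxr hxs⟩

theorem pair_subset (hi : i ∈ K) (hj : j ∈ K) (hK : K ⊆ I) : ({i, j} : Finset (Fin n)) ⊆ I := by
  rw [Finset.insert_subset_iff, Finset.singleton_subset_iff]
  exact ⟨hK hi, hK hj⟩

section extend

variable {σ : MultiHom E.vacant E.toMultiBundle}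
  {T : ∀ J : Finset (Fin n), J.card = 2 → CoreHom E.dec E.toMultiBundle (blockPartition J)}
  {P : Set (Finset (Fin n))} {S : MultiHom E.dec E.toMultiBundle}

/-- The value at `x`, truncated to `K` and the members of `P` that avoid `i`, `j ∈ K`, of the
decomposition of the core defined by `{i, j}`. -/
noncomputable def coreTerm (T : CoreHom E.dec E.toMultiBundle (blockPartition {i, j}))
    (P : Set (Finset (Fin n))) (hi : i ∈ K) (hj : j ∈ K) (hK : K ⊆ I) (x : E.dec.obj I) :
    E.obj I :=
  T.app (isBlockUnion_of_subset (pair_subset hi hj hK)) (trunc (avoiding P K i j) x)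
    (isCore_trunc_avoiding x hi hj)

theorem coreTerm_congr (U : CoreHom E.dec E.toMultiBundle (blockPartition {i, j}))
    (hi : i ∈ K) (hj : j ∈ K) (hK : K ⊆ I) {x y : E.dec.obj I}
    (h : trunc (avoiding P K i j) x = trunc (avoiding P K i j) y) :
    coreTerm U P hi hj hK x = coreTerm U P hi hj hK y :=
  U.app_congr _ h _ _

/-- The value of a partial decomposition and the core term lie over the same point of
`E(I \ {i, j})`, so that the former can be shifted by the latter. -/
theorem shiftable_coreTerm (hS : IsPartialDecomposition σ T P S) (hi : i ∈ K) (hj : j ∈ K)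
    (hij : i ≠ j) (hK : K ⊆ I) (x : E.dec.obj I) :
    Shiftable (X := E.toMultiBundle) i j (S.toFun I x)
      (coreTerm (T {i, j} (Finset.card_pair hij)) P hi hj hK x) := by
  have hc := (T {i, j} (Finset.card_pair hij)).isCore_app
    (isBlockUnion_of_subset (pair_subset hi hj hK))
    (isCore_trunc_avoiding (P := P) x hi hj)
  have hd : Disjoint (I \ {i, j}) {i, j} := Finset.sdiff_disjoint
  have hiJ : i ∈ ({i, j} : Finset (Fin n)) := by simp
  have hjJ : j ∈ ({i, j} : Finset (Fin n)) := by simp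
  refine Shiftable.of_proj (hK hi) (hK hj) hij (J := I \ {i, j}) Finset.sdiff_subset ?_
    (hc i (hK hi) j (hK hj) (Or.inr ⟨hiJ, hjJ⟩) hij)
    (hc j (hK hj) i (hK hi) (Or.inr ⟨hjJ, hiJ⟩) hij.symm) (by simp) (by simp) ?_
  · intro k hk hk'
    by_contra hne
    exact hk' (by simpa [hk] using hne)
  -- over `I \ {i, j}` both elements are given by the decomposition of the core
  rw [coreTerm, CoreHom.proj_app _ _ (isBlockUnion_of_disjoint hd), S.natural,
    hS.apply_core (Finset.card_pair hij) (isBlockUnion_of_disjoint hd) (isCore_of_disjoint hd _)]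
  refine CoreHom.app_congr _ _ ?_ _ _
  rw [proj_trunc]
  refine trunc_congr _ fun L hL h => absurd ?_ h
  have h1 : i ∉ L := fun h => by simpa using hL h
  have h2 : j ∉ L := fun h => by simpa using hL h
  have h3 : L ≠ K := fun e => h1 (e ▸ hi)
  simp [mem_avoiding, h1, h2, h3]

open Classical in
/-- The extension of a partial decomposition from `P` to `insert K P`, where `i`, `j ∈ K`. -/
noncomputable def extendFun (S : MultiHom E.dec E.toMultiBundle)
    (T : CoreHom E.dec E.toMultiBundle (blockPartition {i, j})) (P : Set (Finset (Fin n)))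
    (hi : i ∈ K) (hj : j ∈ K) (I : Finset (Fin n)) (x : E.dec.obj I) : E.obj I :=
  if hK : K ⊆ I then E.shift i j (S.toFun I x) (coreTerm T P hi hj hK x) else S.toFun I x

theorem extendFun_of_subset {U : CoreHom E.dec E.toMultiBundle (blockPartition {i, j})}
    (hi : i ∈ K) (hj : j ∈ K) (hK : K ⊆ I) (x : E.dec.obj I) :
    extendFun S U P hi hj I x = E.shift i j (S.toFun I x) (coreTerm U P hi hj hK x) :=
  dif_pos hK

theorem extendFun_of_not_subset {U : CoreHom E.dec E.toMultiBundle (blockPartition {i, j})}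
    (hi : i ∈ K) (hj : j ∈ K) (hK : ¬K ⊆ I) (x : E.dec.obj I) :
    extendFun S U P hi hj I x = S.toFun I x :=
  dif_neg hK

theorem coreTerm_add (U : CoreHom E.dec E.toMultiBundle (blockPartition {i, j}))
    (hi : i ∈ K) (hj : j ∈ K) (hK : K ⊆ I) {l : Fin n} (hl : l ∈ I) {x y : E.dec.obj I}
    (h : E.dec.p l x = E.dec.p l y) :
    coreTerm U P hi hj hK (E.dec.add l x y)
      = E.add l (coreTerm U P hi hj hK x) (coreTerm U P hi hj hK y) :=
  (U.app_congr _ (trunc_add h) _ _).trans (U.app_add _ hl (isCore_trunc_avoiding x hi hj)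
    (isCore_trunc_avoiding y hi hj) (p_trunc_congr h))

theorem coreTerm_smul (U : CoreHom E.dec E.toMultiBundle (blockPartition {i, j}))
    (hi : i ∈ K) (hj : j ∈ K) (hK : K ⊆ I) {l : Fin n} (hl : l ∈ I) (t : ℝ) (x : E.dec.obj I) :
    coreTerm U P hi hj hK (E.dec.smul l t x) = E.smul l t (coreTerm U P hi hj hK x) :=
  (U.app_congr _ (trunc_smul x t) _ (E.dec.isCore_smul hl t (isCore_trunc_avoiding x hi hj))).trans
    (U.app_smul _ hl t (isCore_trunc_avoiding x hi hj))

theorem coreTerm_eq_zeroAt (U : CoreHom E.dec E.toMultiBundle (blockPartition {i, j}))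
    (hi : i ∈ K) (hj : j ∈ K) (hK : K ⊆ I) {x : E.dec.obj I}
    (h : comp x K hK = E.zeroOver K (base x)) :
    coreTerm U P hi hj hK x = E.zeroAt j (coreTerm U P hi hj hK x) :=
  (U.app_congr _ (trunc_avoiding_eq_zeroAt x fun _ => h) _
    (E.dec.isCore_smul (hK hj) 0 (isCore_trunc_avoiding x hi hj))).trans
    (U.app_smul _ (hK hj) 0 (isCore_trunc_avoiding x hi hj))

theorem p_coreTerm_congr (U : CoreHom E.dec E.toMultiBundle (blockPartition {i, j}))
    (hi : i ∈ K) (hj : j ∈ K) (hK : K ⊆ I) {l : Fin n} (hl : l ∈ I) {x y : E.dec.obj I}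
    (h : E.dec.p l x = E.dec.p l y) :
    E.p l (coreTerm U P hi hj hK x) = E.p l (coreTerm U P hi hj hK y) :=
  U.p_app_congr _ _ _ hl (p_trunc_congr h)

theorem extendFun_of_comp_eq_zero (hS : IsPartialDecomposition σ T P S) (hi : i ∈ K)
    (hj : j ∈ K) (hij : i ≠ j) (x : E.dec.obj I)
    (h : ∀ hK : K ⊆ I, comp x K hK = E.zeroOver K (base x)) :
    extendFun S (T {i, j} (Finset.card_pair hij)) P hi hj I x = S.toFun I x := by
  by_cases hK : K ⊆ I
  · rw [extendFun_of_subset hi hj hK]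
    exact shift_eq_self (hK hi) (hK hj)
      ((shiftable_coreTerm hS hi hj hij hK x).inner (hK hi) (hK hj) hij)
      (coreTerm_eq_zeroAt _ hi hj hK (h hK))
  · exact extendFun_of_not_subset hi hj hK x

/-- Naturality of the extension. If `K` is contained in `I` but not in `I \ {l}`, then the core term
becomes trivial under `p_l`. -/
theorem p_extendFun (hS : IsPartialDecomposition σ T P S) (hi : i ∈ K) (hj : j ∈ K)
    (hij : i ≠ j) {l : Fin n} (hl : l ∈ I) (x : E.dec.obj I) :
    E.p l (extendFun S (T {i, j} (Finset.card_pair hij)) P hi hj I x)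
      = extendFun S (T {i, j} (Finset.card_pair hij)) P hi hj (I.erase l) (E.dec.p l x) := by
  have hiJ : i ∈ ({i, j} : Finset (Fin n)) := by simp
  have hjJ : j ∈ ({i, j} : Finset (Fin n)) := by simp
  by_cases hK : K ⊆ I
  swap
  · rw [extendFun_of_not_subset hi hj hK,
      extendFun_of_not_subset hi hj fun h => hK (h.trans (Finset.erase_subset l I)), S.p_map]
  have hsh := shiftable_coreTerm hS hi hj hij hK x
  rw [extendFun_of_subset hi hj hK]
  rcases eq_or_ne l i with rfl | hli
  · rw [extendFun_of_not_subset hi hj fun h => Finset.notMem_erase l I (h hi),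
      p_left_shift (hK hi) (hK hj) hij hsh, S.p_map]
  rcases eq_or_ne l j with rfl | hlj
  · rw [extendFun_of_not_subset hi hj fun h => Finset.notMem_erase l I (h hj),
      p_right_shift (hK hi) (hK hj) hij hsh, S.p_map]
  have hi' : i ∈ I.erase l := Finset.mem_erase.2 ⟨hli.symm, hK hi⟩
  have hj' : j ∈ I.erase l := Finset.mem_erase.2 ⟨hlj.symm, hK hj⟩
  have hB : IsBlockUnion (blockPartition {i, j}) (I.erase l) :=
    isBlockUnion_of_subset (by
      rw [Finset.insert_subset_iff, Finset.singleton_subset_iff]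
      exact ⟨hi', hj'⟩)
  rw [p_shift (hK hi) (hK hj) hij hl hli hlj hsh, S.p_map]
  have e : E.p l (coreTerm (T {i, j} (Finset.card_pair hij)) P hi hj hK x)
      = (T {i, j} (Finset.card_pair hij)).app hB (trunc (avoiding P K i j) (E.dec.p l x))
        (isCore_trunc_avoiding _ hi hj) := CoreHom.proj_app _ _ hB _ _
  by_cases hK' : K ⊆ I.erase l
  · rw [extendFun_of_subset hi hj hK', e, coreTerm]
  · rw [extendFun_of_not_subset hi hj hK']
    refine shift_eq_self hi' hj' ?_ ?_
    · rw [← S.p_map, ← p_zeroAt hl (hK hi) hli]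
      exact p_p_congr l (hsh.inner (hK hi) (hK hj) hij)
    · rw [e]
      exact (CoreHom.app_congr _ _ (trunc_avoiding_eq_zeroAt _ fun h => absurd h hK') _
        (E.dec.isCore_smul hj' 0 (isCore_trunc_avoiding _ hi hj))).trans
        (CoreHom.app_smul _ _ hj' 0 (isCore_trunc_avoiding _ hi hj))

theorem isPlot_coreTerm (U : CoreHom E.dec E.toMultiBundle (blockPartition {i, j}))
    (hi : i ∈ K) (hj : j ∈ K) (hK : K ⊆ I) {m : ℕ}
    {c : EuclideanSpace ℝ (Fin m) → E.dec.obj I} (hc : @IsPlot _ (E.dec.diffeology I) m c) :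
    @IsPlot _ (E.diffeology I) m (fun u => coreTerm U P hi hj hK (c u)) :=
  U.smooth I (isBlockUnion_of_subset (pair_subset hi hj hK)) m
    (fun u => ⟨trunc (avoiding P K i j) (c u), isCore_trunc_avoiding _ hi hj⟩)
    (fun _ => E.isPlot_trunc _ hc) ()

/-- The extension of a partial decomposition from `P` to `insert K P`, as a morphism. -/
noncomputable def extend (hS : IsPartialDecomposition σ T P S) (hi : i ∈ K) (hj : j ∈ K)
    (hij : i ≠ j) : MultiHom E.dec E.toMultiBundle where
  toFun := extendFun S (T {i, j} (Finset.card_pair hij)) P hi hj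
  smooth I m c hc := by
    by_cases hK : K ⊆ I
    · have e : extendFun S (T {i, j} (Finset.card_pair hij)) P hi hj I ∘ c
          = fun u => E.shift i j (S.toFun I (c u))
            (coreTerm (T {i, j} (Finset.card_pair hij)) P hi hj hK (c u)) :=
        funext fun u => extendFun_of_subset hi hj hK (c u)
      rw [e]
      exact E.isPlot_shift (hK hi) (hK hj) hij (S.smooth I m c hc)
        (isPlot_coreTerm _ hi hj hK hc) fun u => shiftable_coreTerm hS hi hj hij hK (c u)
    · have e : extendFun S (T {i, j} (Finset.card_pair hij)) P hi hj I ∘ c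
          = S.toFun I ∘ c := funext fun u => extendFun_of_not_subset hi hj hK (c u)
      rw [e]
      exact S.smooth I m c hc
  natural h x := natural_of_p (fun _ _ hl x => p_extendFun hS hi hj hij hl x) h x
  map_add := by
    intro I l hl x y h
    by_cases hK : K ⊆ I
    · rw [extendFun_of_subset hi hj hK, extendFun_of_subset hi hj hK,
        extendFun_of_subset hi hj hK, S.map_add hl x y h, coreTerm_add _ hi hj hK hl h]
      exact shift_add (hK hi) (hK hj) hij hl (shiftable_coreTerm hS hi hj hij hK x)
        (shiftable_coreTerm hS hi hj hij hK y) (S.p_map_congr h)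
        (p_coreTerm_congr _ hi hj hK hl h)
    · rw [extendFun_of_not_subset hi hj hK, extendFun_of_not_subset hi hj hK,
        extendFun_of_not_subset hi hj hK, S.map_add hl x y h]
  map_smul := by
    intro I l hl t x
    by_cases hK : K ⊆ I
    · rw [extendFun_of_subset hi hj hK, extendFun_of_subset hi hj hK,
        S.map_smul hl, coreTerm_smul _ hi hj hK hl]
      exact shift_smul (hK hi) (hK hj) hij hl t (shiftable_coreTerm hS hi hj hij hK x)
    · rw [extendFun_of_not_subset hi hj hK, extendFun_of_not_subset hi hj hK, S.map_smul hl]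

theorem IsPartialDecomposition.extend (hS : IsPartialDecomposition σ T P S)
    (hT : ∀ J₁ h₁ J₂ h₂, Compatible (T J₁ h₁) (T J₂ h₂)) (hP : {L | L.card ≤ 1} ⊆ P)
    (hKP : K ∉ P) (hi : i ∈ K) (hj : j ∈ K) (hij : i ≠ j) :
    IsPartialDecomposition σ T (insert K P) (extend hS hi hj hij) where
  apply_trunc := by
    intro I x
    have e : S.toFun I (trunc (insert K P) x) = S.toFun I x := by
      rw [← hS.apply_trunc, trunc_trunc _ (Set.subset_insert K P), hS.apply_trunc]
    change extendFun _ _ _ _ _ _ _ = extendFun _ _ _ _ _ _ _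
    by_cases hK : K ⊆ I
    · rw [extendFun_of_subset hi hj hK, extendFun_of_subset hi hj hK, e,
        coreTerm_congr _ hi hj hK (trunc_trunc x avoiding_subset)]
    · rw [extendFun_of_not_subset hi hj hK, extendFun_of_not_subset hi hj hK, e]
  apply_ι := by
    intro I x
    refine (extendFun_of_comp_eq_zero hS hi hj hij _ fun hK => ?_).trans (hS.apply_ι x)
    rw [← trunc_ι x, comp_trunc_of_notMem _ hK fun h => hKP (hP h), base_trunc]
  apply_core := by
    intro J hJ I hI x hx
    change extendFun _ _ _ _ _ _ _ = _
    by_cases hK : K ⊆ I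
    · have hB := isBlockUnion_of_subset (pair_subset hi hj hK)
      rw [extendFun_of_subset hi hj hK, coreTerm, hS.apply_core hJ hI hx,
        app_eq_of_compatible (hT {i, j} (Finset.card_pair hij) J hJ) hB hI
          (isCore_trunc_avoiding x hi hj) (isCore_trunc hx),
        ← CoreHom.app_shift _ hI (hK hi) (hK hj) hij (shiftable_trunc x hi hj)]
      exact CoreHom.app_congr _ _ (trunc_insert x hi hj hij hK hKP).symm _ _
    · rw [extendFun_of_not_subset hi hj hK, hS.apply_core hJ hI hx]
      exact CoreHom.app_congr _ _ (trunc_insert_of_not_subset x hK).symm _ _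

end extend

/-- The morphism `E^dec → vacant → E` defined by a linear splitting. -/
def compForget (σ : MultiHom E.vacant E.toMultiBundle) : MultiHom E.dec E.toMultiBundle where
  toFun I x := σ.toFun I (forget x)
  smooth I m _ hc := σ.smooth I m _ (E.isPlot_forget hc)
  natural h x := σ.natural h (forget x)
  map_add hi x y h := by
    rw [forget_add h]
    exact σ.map_add hi _ _ (congrArg forget h)
  map_smul hi t x := σ.map_smul hi t (forget x)

/-- On a core element, the components in the lower sides `E({a})`, `a ∈ J`, vanish if `J ⊆ I`. So
the two maps to be compared take values in the zero section over `E(I \ J)`, and the assumption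
for `I \ J` applies. -/
theorem isPartialDecomposition_compForget {σ : MultiHom E.vacant E.toMultiBundle}
    {T : ∀ J : Finset (Fin n), J.card = 2 → CoreHom E.dec E.toMultiBundle (blockPartition J)}
    (hσ : ∀ J hJ, SplittingCompatible σ (T J hJ)) :
    IsPartialDecomposition σ T {K | K.card ≤ 1} (compForget σ) where
  apply_trunc x := congrArg (σ.toFun _) (forget_trunc subset_rfl x)
  apply_ι x := congrArg (σ.toFun _) (forget_ι x)
  apply_core := by
    intro J hJ
    have hdisj : ∀ {I : Finset (Fin n)} (h : Disjoint I J) (x : E.dec.obj I),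
        σ.toFun I (forget x) = (T J hJ).app (isBlockUnion_of_disjoint h)
          (trunc {K | K.card ≤ 1} x) (isCore_of_disjoint h _) :=
      fun h x => (hσ J hJ _ h (forget x)).trans (CoreHom.app_congr _ _ (ι_forget x) _ _)
    intro I hI x hx
    by_cases hIJ : Disjoint I J
    · exact hdisj hIJ x
    have hJI : J ⊆ I := by
      obtain ⟨a, haI, haJ⟩ := Finset.not_disjoint_iff.1 hIJ
      exact fun b hb => hI a b (Or.inr ⟨haJ, hb⟩) haI
    -- the truncation of `x` is zero in both directions of `J`
    have hz : ∀ a ∈ J, trunc {K | K.card ≤ 1} x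
        = E.dec.zeroAt a (trunc {K | K.card ≤ 1} x) := by
      intro a ha
      obtain ⟨b, hb, hba⟩ := Finset.exists_mem_ne (by omega : 1 < J.card) a
      refine dec_ext fun L hL => ?_
      by_cases haL : a ∈ L
      · rw [comp_zeroAt_of_mem _ hL haL, base_trunc]
        by_cases hLc : L.card ≤ 1
        · rw [comp_trunc_of_mem x hL hLc]
          exact dec_isCore_iff.1 hx L hL b (hJI hb) a haL (Or.inr ⟨hb, ha⟩)
            fun hbL => hba (Finset.card_le_one.1 hLc b hbL a haL)
        · exact comp_trunc_of_notMem x hL hLc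
      · rw [comp_zeroAt_of_notMem _ hL haL]
    have hsub : I \ J ⊆ I := Finset.sdiff_subset
    have hd : Disjoint (I \ J) J := Finset.sdiff_disjoint
    refine E.zero_unique I hsub _ _ ?_ ?_ ?_
    · intro k hk hk'
      have hkJ : k ∈ J := by
        by_contra h
        exact hk' (Finset.mem_sdiff.2 ⟨hk, h⟩)
      rw [← (compForget σ).map_zeroAt hk]
      change σ.toFun I (forget x) = σ.toFun I (forget (E.dec.zeroAt k x))
      rw [← forget_trunc subset_rfl x, ← forget_trunc subset_rfl (E.dec.zeroAt k x)]
      refine congrArg (fun z => σ.toFun I (forget z)) ((hz k hkJ).trans ?_)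
      exact (trunc_smul x 0).symm
    · intro k hk hk'
      have hkJ : k ∈ J := by
        by_contra h
        exact hk' (Finset.mem_sdiff.2 ⟨hk, h⟩)
      exact (CoreHom.app_congr _ _ (hz k hkJ) _
        (E.dec.isCore_smul hk 0 (isCore_trunc hx))).trans
        (CoreHom.app_smul _ _ hk 0 (isCore_trunc hx))
    · rw [(compForget σ).natural hsub, CoreHom.proj_app _ _ (isBlockUnion_of_disjoint hd)]
      exact hdisj hd _

/-- Induction over collections of subsets: starting from the subsets with at most one element, all
other subsets are added one at a time, each together with a pair of distinct elements of it. -/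
theorem collection_induction {Q : Set (Finset (Fin n)) → Prop}
    (base : Q {K | K.card ≤ 1})
    (step : ∀ (P : Set (Finset (Fin n))) (K : Finset (Fin n)) (i j : Fin n),
      {L | L.card ≤ 1} ⊆ P → K ∉ P → i ∈ K → j ∈ K → i ≠ j → Q P → Q (insert K P)) :
    Q Set.univ := by
  have key : ∀ A : Finset (Finset (Fin n)), Q ({K | K.card ≤ 1} ∪ (A : Set (Finset (Fin n)))) := by
    intro A
    induction A using Finset.induction with
    | empty => simpa using base
    | insert K A _ ih =>
      rw [Finset.coe_insert, Set.union_insert]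
      by_cases hK : K ∈ {K : Finset (Fin n) | K.card ≤ 1} ∪ (A : Set (Finset (Fin n)))
      · rwa [Set.insert_eq_of_mem hK]
      · have hc : 1 < K.card := not_le.1 fun h => hK (Or.inl h)
        obtain ⟨i, hi, j, hj, hij⟩ := Finset.one_lt_card.1 hc
        exact step _ K i j Set.subset_union_left hK hi hj hij ih
  simpa using key Finset.univ

theorem exists_isPartialDecomposition_univ {σ : MultiHom E.vacant E.toMultiBundle}
    {T : ∀ J : Finset (Fin n), J.card = 2 → CoreHom E.dec E.toMultiBundle (blockPartition J)}
    (hT : ∀ J₁ h₁ J₂ h₂, Compatible (T J₁ h₁) (T J₂ h₂))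
    (hσ : ∀ J hJ, SplittingCompatible σ (T J hJ)) :
    ∃ S, IsPartialDecomposition σ T Set.univ S :=
  collection_induction (Q := fun P => ∃ S, IsPartialDecomposition σ T P S)
    ⟨_, isPartialDecomposition_compForget hσ⟩
    fun _ _ _ _ hP hKP hi hj hij ⟨_, hS⟩ => ⟨_, hS.extend hT hP hKP hi hj hij⟩

/-- A morphism `E^dec → E` is determined by its restrictions to the vacant decomposed bundle and to
the highest order cores. -/
theorem multiHom_ext {S S' : MultiHom E.dec E.toMultiBundle}
    (hι : ∀ (I : Finset (Fin n)) (x : E.vacant.obj I),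
      S.toFun I (E.ι I x) = S'.toFun I (E.ι I x))
    (hcore : ∀ J : Finset (Fin n), J.card = 2 →
      S.core (blockPartition J) = S'.core (blockPartition J)) : S = S' := by
  have key : ∀ (I : Finset (Fin n)) (x : E.dec.obj I),
      S.toFun I (trunc Set.univ x) = S'.toFun I (trunc Set.univ x) := by
    refine collection_induction (Q := fun P => ∀ (I : Finset (Fin n)) (x : E.dec.obj I),
      S.toFun I (trunc P x) = S'.toFun I (trunc P x)) ?_ ?_
    · intro I x
      rw [← ι_forget, hι]
    · intro P K i j _ hKP hi hj hij ih I x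
      by_cases hK : K ⊆ I
      · have hsh := shiftable_trunc (P := P) x hi hj
        have e := congrArg (fun f : CoreHom E.dec E.toMultiBundle (blockPartition {i, j}) =>
          f.app (isBlockUnion_of_subset (pair_subset hi hj hK)) _
            (isCore_trunc_avoiding (P := P) x hi hj)) (hcore _ (Finset.card_pair hij))
        have e' : S.toFun I (trunc (avoiding P K i j) x)
          = S'.toFun I (trunc (avoiding P K i j) x) := e
        rw [trunc_insert x hi hj hij hK hKP, S.map_shift (hK hi) (hK hj) hij hsh,
          S'.map_shift (hK hi) (hK hj) hij hsh, ih, e']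
      · rw [trunc_insert_of_not_subset x hK, ih]
  refine MultiHom.ext (funext fun I => funext fun x => ?_)
  rw [← trunc_univ x, key]

end NFoldVectorBundle

/-! ### Morphisms that are the identity on the building bundles are isomorphisms -/

namespace MultiBundle

variable {n : ℕ} {X Y : MultiBundle.{u} n} {E : MultiBundle.{u} n} {I : Finset (Fin n)}
  {i j : Fin n}

variable (X) in
/-- The difference in the fibres of `p_i`. -/
def sub (i : Fin n) (x y : X.obj I) : X.obj I := X.add i x (X.smul i (-1) y)

theorem sub_add (hi : i ∈ I) {x y : X.obj I} (h : X.p i x = X.p i y) :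
    X.add i (X.sub i x y) y = x :=
  add_neg_add hi h

theorem p_sub_self (hi : i ∈ I) {x y : X.obj I} (h : X.p i x = X.p i y) :
    X.p i (X.sub i x y) = X.p i y :=
  (X.p_add_self hi _ _ (h.trans (X.p_smul_self hi _ _).symm)).trans h

/-- If `x` and `y` have the same projections, then the difference `x - y` has the same projections
as the zero vector. -/
theorem p_sub (hi : i ∈ I) (hj : j ∈ I) {x y : X.obj I} (h : X.p i x = X.p i y)
    (h' : X.p j x = X.p j y) : X.p j (X.sub i x y) = X.p j (X.zeroAt i y) := by
  rw [← add_neg_self hi y]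
  exact p_add_congr hi hj h' rfl (h.trans (X.p_smul_self hi _ _).symm)
    (X.p_smul_self hi _ _).symm

theorem _root_.MultiHom.map_sub (f : MultiHom X Y) (hi : i ∈ I) {x y : X.obj I}
    (h : X.p i x = X.p i y) :
    f.toFun I (X.sub i x y) = Y.sub i (f.toFun I x) (f.toFun I y) := by
  rw [sub, f.map_add hi _ _ (h.trans (X.p_smul_self hi _ _).symm), f.map_smul hi, sub]

/-- A vector that is zero in all directions of `I \ insert a B` becomes zero in all directions of
`I \ B` when multiplied by zero in the direction `a`. -/
theorem zeroAt_zero_outside {a : Fin n} {B : Finset (Fin n)} (ha : a ∈ I) {y : X.obj I}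
    (h : ∀ k ∈ I, k ∉ insert a B → y = X.zeroAt k y) :
    ∀ k ∈ I, k ∉ B → X.zeroAt a y = X.zeroAt k (X.zeroAt a y) := by
  intro k hk hkB
  rcases eq_or_ne k a with rfl | hka
  · exact (zeroAt_zeroAt hk y).symm
  · have hkB' : k ∉ insert a B := by simp [hka, hkB]
    conv_lhs => rw [h k hk hkB']
    exact smul_comm_any ha hk 0 0 y

/-- A vector with the same projections as an iterated zero vector is an element of `X^I_I`. -/
theorem isCore_top_of_p_eq {x y : X.obj I} (hy : ∀ k ∈ I, y = X.zeroAt k y)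
    (h : ∀ k ∈ I, X.p k x = X.p k y) : X.IsCore ⊤ x := by
  intro j hj k hk _ hne
  rw [h j hj]
  conv_lhs => rw [hy k hk]
  exact p_zeroAt hj hk hne y

theorem dec_ext_of_p {x y : E.dec.obj I} (h : ∀ k ∈ I, E.dec.p k x = E.dec.p k y)
    (htop : E.top x = E.top y) : x = y := by
  refine dec_ext fun K hK => ?_
  rcases eq_or_ne K I with rfl | hne
  · exact htop
  · obtain ⟨k, hk, hkK⟩ := Finset.exists_of_ssubset (lt_of_le_of_ne hK hne)
    exact comp_congr (h k hk) hK hkK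

/-- The element of `E^dec(I)` with given components. -/
def assemble (I : Finset (Fin n)) (m : E.obj ∅) (f : ∀ K, E.obj K)
    (hf : ∀ K, E.IsCore ⊤ (f K) ∧ E.proj (Finset.empty_subset K) (f K) = m) : E.dec.obj I :=
  (⟨fun K _ _ => f K, fun K _ _ => ⟨(hf K).1, (hf K).2.trans (by
    rw [← (hf ∅).2, E.proj_refl])⟩⟩ : E.DecompObj Set.univ (Set.mem_univ _) I)

theorem comp_assemble {m : E.obj ∅} {f : ∀ K, E.obj K}
    (hf : ∀ K, E.IsCore ⊤ (f K) ∧ E.proj (Finset.empty_subset K) (f K) = m)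
    {K : Finset (Fin n)} (hK : K ⊆ I) : comp (assemble I m f hf) K hK = f K := rfl

section bijective

variable {S : MultiHom E.dec E}
  (hS : ∀ (I : Finset (Fin n)) (x : E.dec.obj I), E.dec.IsCore ⊤ x → S.toFun I x = E.top x)

include hS

theorem proj_empty_apply (x : E.dec.obj I) :
    E.proj (Finset.empty_subset I) (S.toFun I x) = base x := by
  rw [S.natural]
  exact hS ∅ _ fun j hj => absurd hj (Finset.notMem_empty j)

theorem injective_of_core_id (I : Finset (Fin n)) : Function.Injective (S.toFun I) := by
  induction I using Finset.strongInduction with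
  | H I ih =>
    -- subtracting `y` from `x` in all directions reduces the claim to elements of `E^I_I`
    have key : ∀ B : Finset (Fin n), B ⊆ I → ∀ x y : E.dec.obj I,
        (∀ k ∈ I, E.dec.p k x = E.dec.p k y) → (∀ k ∈ I, k ∉ B → y = E.dec.zeroAt k y) →
        S.toFun I x = S.toFun I y → x = y := by
      intro B
      induction B using Finset.induction with
      | empty =>
        intro _ x y hp hz h
        have hz' : ∀ k ∈ I, y = E.dec.zeroAt k y := fun k hk => hz k hk (Finset.notMem_empty k)
        refine dec_ext_of_p hp ?_
        rw [← hS I x (isCore_top_of_p_eq hz' hp), ← hS I y (isCore_top_of_p_eq hz' fun _ _ => rfl),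
          h]
      | insert a B _ ihB =>
        intro hB x y hp hz h
        have ha : a ∈ I := hB (Finset.mem_insert_self a B)
        have e : E.dec.sub a x y = E.dec.zeroAt a y := by
          refine ihB ((Finset.subset_insert a B).trans hB) _ _
            (fun k hk => p_sub ha hk (hp a ha) (hp k hk)) (zeroAt_zero_outside ha hz) ?_
          rw [S.map_sub ha (hp a ha), h, S.map_zeroAt ha]
          exact add_neg_self ha _
        rw [← sub_add ha (hp a ha), e, zeroAt_add ha]
    intro x y h
    refine key I (Finset.Subset.refl I) x y (fun k hk => ?_) (fun k hk hk' => absurd hk hk') h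
    exact ih _ (Finset.erase_ssubset hk) (by rw [← S.p_map, ← S.p_map, h])

/-- If `e` and `S x₀` have the same projections, then `e` is in the image of `S`: subtracting
`S x₀` in all directions `k ∈ B`, outside of which `x₀` vanishes already, leaves an element of
`E^I_I`. -/
theorem exists_apply_eq_of_p_eq {B : Finset (Fin n)} (hB : B ⊆ I) :
    ∀ (e : E.obj I) (x₀ : E.dec.obj I),
      E.proj (Finset.empty_subset I) e = base x₀ →
      (∀ k ∈ I, E.p k e = E.p k (S.toFun I x₀)) →
      (∀ k ∈ I, k ∉ B → x₀ = E.dec.zeroAt k x₀) →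
      ∃ x, S.toFun I x = e ∧ ∀ k ∈ I, E.dec.p k x = E.dec.p k x₀ := by
  induction B using Finset.induction with
  | empty =>
    classical
    intro e x₀ hb hp hz
    have hz' : ∀ k ∈ I, x₀ = E.dec.zeroAt k x₀ := fun k hk => hz k hk (Finset.notMem_empty k)
    have he : E.IsCore ⊤ e := by
      refine isCore_top_of_p_eq (y := S.toFun I x₀) (fun k hk => ?_) hp
      rw [← S.map_zeroAt hk, ← hz' k hk]
    -- the components of `x₀`, with `e` in place of the component in `E^I_I`
    have hf : ∀ K, E.IsCore ⊤ (Function.update (fun K => if hK : K ⊆ I then comp x₀ K hK else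
        E.zeroOver K (base x₀)) I e K) ∧ E.proj (Finset.empty_subset K)
        (Function.update (fun K => if hK : K ⊆ I then comp x₀ K hK else
        E.zeroOver K (base x₀)) I e K) = base x₀ := by
      intro K
      rcases eq_or_ne K I with rfl | hne
      · rw [Function.update_self]
        exact ⟨he, hb⟩
      · rw [Function.update_of_ne hne]
        split_ifs with hK
        · exact ⟨isCore_comp x₀ hK, proj_comp x₀ hK⟩
        · exact ⟨E.isCore_zeroOver _ _ _, E.proj_zeroOver _ _⟩
    have hpx : ∀ k ∈ I, E.dec.p k (assemble I (base x₀) _ hf) = E.dec.p k x₀ := by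
      intro k hk
      refine dec_ext fun K hK => ?_
      obtain ⟨hK, hkK⟩ := Finset.subset_erase.1 hK
      refine (comp_assemble hf hK).trans ?_
      rw [Function.update_of_ne fun h : K = I => hkK (h ▸ hk)]
      exact dif_pos hK
    refine ⟨assemble I (base x₀) _ hf, ?_, hpx⟩
    rw [hS I _ (isCore_top_of_p_eq hz' hpx)]
    refine (comp_assemble hf (Finset.Subset.refl I)).trans ?_
    rw [Function.update_self]
  | insert a B _ ih =>
    intro e x₀ hb hp hz
    have ha : a ∈ I := hB (Finset.mem_insert_self a B)
    obtain ⟨x, hx, hpx⟩ := ih ((Finset.subset_insert a B).trans hB)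
      (E.sub a e (S.toFun I x₀)) (E.dec.zeroAt a x₀)
      (by
        rw [base_congr (p_zeroAt_self ha x₀), ← hb]
        exact proj_empty_add ha ((hp a ha).trans (E.p_smul_self ha _ _).symm))
      (fun k hk => by
        rw [S.map_zeroAt ha]
        exact p_sub ha hk (hp a ha) (hp k hk))
      (zeroAt_zero_outside ha hz)
    have hxa : E.dec.p a x = E.dec.p a x₀ := (hpx a ha).trans (p_zeroAt_self ha x₀)
    refine ⟨E.dec.add a x x₀, ?_, fun k hk => ?_⟩
    · rw [S.map_add ha _ _ hxa, hx, sub_add ha (hp a ha)]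
    · rw [p_add_congr ha hk (hpx k hk) rfl hxa (p_zeroAt_self ha x₀), zeroAt_add ha]

/-- Given the preimages of all proper projections of `e`, their components form an element of
`E^dec(I)` whose image has the same projections as `e`. -/
theorem surjective_of_core_id (I : Finset (Fin n)) : Function.Surjective (S.toFun I) := by
  classical
  induction I using Finset.strongInduction with
  | H I ih =>
    intro e
    -- preimages of the projections of `e`
    choose g hg using fun (K : Finset (Fin n)) (hK : K ⊂ I) => ih K hK (E.proj hK.1 e)
    have hbase : ∀ K hK, base (g K hK) = E.proj (Finset.empty_subset I) e := by
      intro K hK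
      rw [← proj_empty_apply hS, hg, E.proj_proj]
    have hproj : ∀ K L (hK : K ⊂ I) (hL : L ⊂ I) (h : K ⊆ L),
        E.dec.proj h (g L hL) = g K hK := by
      intro K L hK hL h
      apply injective_of_core_id hS
      rw [← S.natural, hg, hg, E.proj_proj]
    have hf : ∀ K, E.IsCore ⊤ (if hK : K ⊂ I then comp (g K hK) K (Finset.Subset.refl K)
          else E.zeroOver K (E.proj (Finset.empty_subset I) e)) ∧
        E.proj (Finset.empty_subset K) (if hK : K ⊂ I then
          comp (g K hK) K (Finset.Subset.refl K)
          else E.zeroOver K (E.proj (Finset.empty_subset I) e))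
          = E.proj (Finset.empty_subset I) e := by
      intro K
      split_ifs with hK
      · exact ⟨isCore_comp _ _, (proj_comp _ _).trans (hbase K hK)⟩
      · exact ⟨E.isCore_zeroOver _ _ _, E.proj_zeroOver _ _⟩
    have hp : ∀ k (hk : k ∈ I), E.dec.p k (assemble I _ _ hf)
        = g (I.erase k) (Finset.erase_ssubset hk) := by
      intro k hk
      refine dec_ext fun K hK => ?_
      have hKI : K ⊂ I := lt_of_le_of_lt hK (Finset.erase_ssubset hk)
      refine (comp_assemble hf hKI.1).trans ((dif_pos hKI).trans ?_)
      rw [← hproj K _ hKI (Finset.erase_ssubset hk) hK]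
      rfl
    have hb : E.proj (Finset.empty_subset I) e = base (assemble I _ _ hf) := by
      refine Eq.trans ?_ (comp_assemble hf (Finset.empty_subset I)).symm
      exact (hf ∅).2.symm.trans (E.proj_refl _)
    obtain ⟨x, hx, _⟩ := exists_apply_eq_of_p_eq hS (Finset.Subset.refl I) e (assemble I _ _ hf)
      hb (fun k hk => by
        rw [S.p_map, hp k hk, hg]
        rfl) fun k hk hk' => absurd hk hk'
    exact ⟨x, hx⟩

end bijective

end MultiBundle

namespace NFoldVectorBundle

open MultiBundle

variable {n : ℕ} {E : NFoldVectorBundle.{u} n} {I : Finset (Fin n)} {m : ℕ}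
  {S : MultiHom E.dec E.toMultiBundle}
  (hS : ∀ (I : Finset (Fin n)) (x : E.dec.obj I), E.dec.IsCore ⊤ x → S.toFun I x = E.top x)

theorem isPlot_sub {i : Fin n} (hi : i ∈ I) {c d : EuclideanSpace ℝ (Fin m) → E.obj I}
    (hc : @IsPlot _ (E.diffeology I) m c) (hd : @IsPlot _ (E.diffeology I) m d)
    (h : ∀ u, E.p i (c u) = E.p i (d u)) :
    @IsPlot _ (E.diffeology I) m (fun u => E.sub i (c u) (d u)) :=
  E.isPlot_add hi hc (E.isPlot_smul hi (-1) hd)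
    fun u => (h u).trans (E.p_smul_self hi _ _).symm

theorem isPlot_dec_zeroAt {i : Fin n} {c : EuclideanSpace ℝ (Fin m) → E.dec.obj I}
    (hc : @IsPlot _ (E.dec.diffeology I) m c) :
    @IsPlot _ (E.dec.diffeology I) m (fun u => E.dec.zeroAt i (c u)) := by
  rw [isPlot_dec_iff] at hc ⊢
  intro K hK
  by_cases hi : i ∈ K
  · have e : (fun u => comp (E.dec.zeroAt i (c u)) K hK)
        = fun u => E.smul i 0 (comp (c u) K hK) :=
      funext fun u => comp_smul_of_mem _ 0 hK hi
    rw [e]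
    exact E.isPlot_smul hi 0 (hc K hK)
  · simp only [comp_zeroAt_of_notMem _ hK hi]
    exact hc K hK

include hS

/-- If `S ∘ x` is smooth and `x` agrees with a smooth map except for the component in `E^I_I`, then
this component is smooth, too. -/
theorem isPlot_top_of_p_eq {B : Finset (Fin n)} (hB : B ⊆ I) :
    ∀ x x₀ : EuclideanSpace ℝ (Fin m) → E.dec.obj I,
      @IsPlot _ (E.diffeology I) m (fun u => S.toFun I (x u)) →
      @IsPlot _ (E.dec.diffeology I) m x₀ →
      (∀ u, ∀ k ∈ I, E.dec.p k (x u) = E.dec.p k (x₀ u)) →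
      (∀ u, ∀ k ∈ I, k ∉ B → x₀ u = E.dec.zeroAt k (x₀ u)) →
      @IsPlot _ (E.diffeology I) m (fun u => E.top (x u)) := by
  induction B using Finset.induction with
  | empty =>
    intro x x₀ hx _ hp hz
    have e : ∀ u, S.toFun I (x u) = E.top (x u) := fun u =>
      hS I _ (isCore_top_of_p_eq (fun k hk => hz u k hk (Finset.notMem_empty k)) (hp u))
    simpa only [e] using hx
  | insert a B _ ih =>
    intro x x₀ hx hx₀ hp hz
    have ha : a ∈ I := hB (Finset.mem_insert_self a B)
    have hpa : ∀ u, E.dec.p a (x u) = E.dec.p a (x₀ u) := fun u => hp u a ha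
    have h := ih ((Finset.subset_insert a B).trans hB) (fun u => E.dec.sub a (x u) (x₀ u))
      (fun u => E.dec.zeroAt a (x₀ u))
      (by
        simp only [S.map_sub ha (hpa _)]
        exact isPlot_sub ha hx (S.smooth I m _ hx₀) fun u => S.p_map_congr (hpa u))
      (isPlot_dec_zeroAt hx₀) (fun u k hk => p_sub ha hk (hpa u) (hp u k hk))
      (fun u => zeroAt_zero_outside ha (hz u))
    have hps : ∀ u, E.dec.p a (E.dec.sub a (x u) (x₀ u)) = E.dec.p a (x₀ u) :=
      fun u => p_sub_self ha (hpa u)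
    have e : ∀ u, E.top (x u)
        = E.add a (E.top (E.dec.sub a (x u) (x₀ u))) (E.top (x₀ u)) := by
      intro u
      conv_lhs => rw [← sub_add ha (hpa u)]
      exact comp_add_of_mem (hps u) (Finset.Subset.refl I) ha
    simp only [e]
    exact E.isPlot_add ha h ((E.isPlot_dec_iff).1 hx₀ I (Finset.Subset.refl I))
      fun u => p_comp_congr (hps u) (Finset.Subset.refl I) ha

theorem isPlot_of_isPlot_apply (I : Finset (Fin n)) :
    ∀ x : EuclideanSpace ℝ (Fin m) → E.dec.obj I,
      @IsPlot _ (E.diffeology I) m (fun u => S.toFun I (x u)) →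
      @IsPlot _ (E.dec.diffeology I) m x := by
  induction I using Finset.strongInduction with
  | H I ih =>
    intro x hx
    have hlt : ∀ K (hK : K ⊆ I), K ≠ I →
        @IsPlot _ (E.diffeology K) m (fun u => comp (x u) K hK) := by
      intro K hK hne
      have h := ih K (lt_of_le_of_ne hK hne) (fun u => E.dec.proj hK (x u)) (by
        simp only [← S.natural]
        exact E.isPlot_proj hK hx)
      exact (E.isPlot_dec_iff).1 h K (Finset.Subset.refl K)
    rw [isPlot_dec_iff]
    intro K hK
    rcases eq_or_ne K I with rfl | hne
    swap
    · exact hlt K hK hne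
    refine isPlot_top_of_p_eq hS (Finset.Subset.refl K) x (fun u => trunc {L | L ≠ K} (x u)) hx
      ?_ ?_ fun u k hk hk' => absurd hk hk'
    · refine E.isPlot_trunc_of_comp _ (fun L hL hne => hlt L hL hne) fun L hL hne => ?_
      obtain rfl : L = K := not_not.1 hne
      exact ⟨_, hx, fun u => proj_empty_apply hS (x u)⟩
    · intro u k hk
      refine dec_ext fun L hL => ?_
      obtain ⟨hL, hkL⟩ := Finset.subset_erase.1 hL
      exact (comp_trunc_of_mem (P := {L | L ≠ K}) (x u) hL fun h : L = K => hkL (h ▸ hk)).symm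

theorem isIso_of_core_id : S.IsIso := by
  have hbij : ∀ I, Function.Bijective (S.toFun I) := fun I =>
    ⟨injective_of_core_id hS I, surjective_of_core_id hS I⟩
  choose g hg using fun I => (hbij I).2
  have hg' : ∀ I x, g I (S.toFun I x) = x := fun I x => (hbij I).1 (hg I _)
  have hnat : ∀ {I J : Finset (Fin n)} (h : J ⊆ I) (y : E.obj I),
      E.dec.proj h (g I y) = g J (E.proj h y) := fun h y =>
    (hbij _).1 (by rw [← S.natural, hg, hg])
  have hp : ∀ {I : Finset (Fin n)} (i : Fin n) (x y : E.obj I), E.p i x = E.p i y →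
      E.dec.p i (g I x) = E.dec.p i (g I y) := fun i x y h =>
    (hnat _ x).trans ((congrArg (g _) h).trans (hnat _ y).symm)
  exact ⟨{
    toFun := g
    smooth := fun I m c hc => isPlot_of_isPlot_apply hS I _ (by
      have e : (fun u => S.toFun I ((g I ∘ c) u)) = c := funext fun u => hg I (c u)
      rw [e]
      exact hc)
    natural := hnat
    map_add := fun hi x y h => (hbij _).1 (by
      rw [hg, S.map_add hi _ _ (hp _ x y h), hg, hg])
    map_smul := fun hi t x => (hbij _).1 (by rw [hg, S.map_smul hi, hg]) }, hg', hg⟩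

end NFoldVectorBundle

/-! ### Existence and uniqueness of the decomposition -/

namespace NFoldVectorBundle

open MultiBundle

variable {n : ℕ} {E : NFoldVectorBundle.{u} n}

/-- A morphism `E^dec → E` that extends a linear splitting and decompositions of the highest order
cores is the identity on the building bundles: `E^∅_∅` and the lower sides are in the image of `ι`,
and `E^I_I` with `#I ≥ 2` is contained in a highest order core. -/
theorem IsPartialDecomposition.eq_top (hn : 1 ≤ n) {σ : MultiHom E.vacant E.toMultiBundle}
    {T : ∀ J : Finset (Fin n), J.card = 2 → CoreHom E.dec E.toMultiBundle (blockPartition J)}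
    {S : MultiHom E.dec E.toMultiBundle} (hS : IsPartialDecomposition σ T Set.univ S)
    (hσ : E.IsLinearSplitting σ) (hT : ∀ J hJ, E.IsCoreDecomposition (T J hJ))
    (I : Finset (Fin n)) (x : E.dec.obj I) (hx : E.dec.IsCore ⊤ x) : S.toFun I x = E.top x := by
  have hsingle : ∀ (i : Fin n) (x : E.dec.obj {i}), S.toFun {i} x = E.top x := by
    intro i x
    have e : E.ι {i} (forget x) = x := by
      rw [ι_forget]
      refine trunc_eq_self x fun K hK h => absurd ?_ h
      exact (Finset.card_le_card hK).trans (Finset.card_singleton i).le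
    rw [← e, hS.apply_ι, hσ.2, e]
    rfl
  rcases Nat.lt_or_ge 1 I.card with h1 | h1
  · obtain ⟨J, hJI, hJ⟩ := Finset.exists_subset_card_eq h1
    have hI := isBlockUnion_of_subset hJI
    rw [hS.apply_core hJ hI (E.dec.isCore_mono le_top hx)]
    refine ((T J hJ).app_congr hI (trunc_univ x) _ (E.dec.isCore_mono le_top hx)).trans ?_
    exact (hT J hJ).2 I hI ⟨x, E.dec.isCore_mono le_top hx⟩ hx
  -- now `I` has at most one element
  have _ : Nonempty (Fin n) := ⟨⟨0, hn⟩⟩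
  rcases Finset.card_le_one_iff_subset_singleton.1 h1 with ⟨i, hi⟩
  rcases Finset.subset_singleton_iff.1 hi with rfl | rfl
  · -- a point of `M` is the projection of a point of a lower side
    let i₀ : Fin n := ⟨0, hn⟩
    obtain ⟨y, hy⟩ : ∃ y : E.dec.obj {i₀}, E.dec.proj (Finset.empty_subset _) y = x :=
      ⟨_, E.dec.proj_zeroOver {i₀} x⟩
    rw [← hy, ← S.natural, hsingle]
    exact proj_comp y (Finset.Subset.refl _)
  · exact hsingle _ x

end NFoldVectorBundle

theorem mainTheorem10 (n : ℕ) (hn : 1 ≤ n) (E : NFoldVectorBundle.{u} n)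
    (splitting : MultiHom E.vacant E.toMultiBundle)
    (hsplitting : E.IsLinearSplitting splitting)
    (coreDec : ∀ J : Finset (Fin n), J.card = 2 →
      CoreHom E.dec E.toMultiBundle (blockPartition J))
    (hcoreDec : ∀ J hJ, E.IsCoreDecomposition (coreDec J hJ))
    (hcompatible : ∀ J₁ h₁ J₂ h₂,
      MultiBundle.Compatible (coreDec J₁ h₁) (coreDec J₂ h₂))
    (hsplittingCompatible : ∀ J hJ,
      MultiBundle.SplittingCompatible splitting (coreDec J hJ)) :
    ∃! S : MultiHom E.dec E.toMultiBundle,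
      E.IsDecomposition S ∧
      (∀ (I : Finset (Fin n)) (x : E.vacant.obj I),
        splitting.toFun I x = S.toFun I (E.ι I x)) ∧
      ∀ J hJ, S.core (blockPartition J) = coreDec J hJ := by
  obtain ⟨S, hS⟩ :=
    NFoldVectorBundle.exists_isPartialDecomposition_univ hcompatible hsplittingCompatible
  have htop := hS.eq_top hn hsplitting hcoreDec
  refine ⟨S, ⟨⟨NFoldVectorBundle.isIso_of_core_id htop, htop⟩,
    fun I x => (hS.apply_ι x).symm, ?_⟩, ?_⟩
  · intro J hJ
    refine CoreHom.ext (funext fun I => funext fun hI => funext fun x => Subtype.ext ?_)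
    refine (hS.apply_core hJ hI x.2).trans ?_
    exact (coreDec J hJ).app_congr hI (MultiBundle.trunc_univ x.1) _ x.2
  · rintro S' ⟨_, hι, hcore⟩
    refine NFoldVectorBundle.multiHom_ext (fun I x => ?_) fun J hJ => ?_
    · rw [← hι, hS.apply_ι]
    · rw [hcore J hJ]
      refine CoreHom.ext (funext fun I => funext fun hI => funext fun x => Subtype.ext ?_)
      refine Eq.symm ((hS.apply_core hJ hI x.2).trans ?_)
      exact (coreDec J hJ).app_congr hI (MultiBundle.trunc_univ x.1) _ x.2
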